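/- Let $(\Omega,\mathcal F,P)$ be a probability space. For a random variable $Y$ and $0<p<1$ put $\mathrm{VaR}_p(Y)=\inf\{y: P(Y\le y)\ge p\}$, and for $0\le\alpha<1$ put $\mathrm{AVaR}_\alpha(Y)=\frac1{1-\alpha}\int_\alpha^1\mathrm{VaR}_u(Y)\,du$. Let $\sigma:[0,1)\to[0,\infty)$ be nondecreasing and integrable with $\int_0^1\sigma(u)\,du=1$. Random variables that agree almost surely are identified. Let $$\|Y\|_\sigma=\int_0^1\sigma(u)\,\mathrm{VaR}_u(|Y|)\,du\in[0,\infty],\qquad L_\sigma=\{Y\in L^0:\|Y\|_\sigma<\infty\},$$ and, for $Z\in L^1$, $$\|Z\|_\sigma^*=\inf\Big\{\eta\ge0:\ \mathrm{AVaR}_\alpha(|Z|)\le\frac{\eta}{1-\alpha}\int_\alpha^1\sigma(u)\,du\ \text{ for all }0\le\alpha<1\Big\},\qquad L_\sigma^*=\{Z\in L^1:\|Z\|_\sigma^*<\infty\}$$ (with $\inf\emptyset=\infty$). Both are normed spaces. Theorem. The space $(L_\sigma^*,\|\cdot\|_\sigma^*)$ is the dual of $(L_\sigma,\|\cdot\|_\sigma)$.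 Precisely: (1) For all $Y\in L_\sigma$ and $Z\in L_\sigma^*$ the product $YZ$ is integrable and $|\mathbb E\,YZ|\le\|Y\|_\sigma\,\|Z\|_\sigma^*$. (2) The map $Z\mapsto(Y\mapsto\mathbb E\,YZ)$ is a linear isometric bijection of $(L_\sigma^*,\|\cdot\|_\sigma^*)$ onto the space of continuous linear functionals on $(L_\sigma,\|\cdot\|_\sigma)$ with the operator norm. (3) For every continuous linear functional $\zeta$ on $L_\sigma$, $A\mapsto\zeta(\mathbf 1_A)$ is a signed measure on $\mathcal F$ that is absolutely continuous with respect to $P$, and the $Z\in L_\sigma^*$ that represents $\zeta$ is its Radon–Nikodym density with respect to $P$. -/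

import Mathlib

open MeasureTheory Set Filter Topology
open scoped ENNReal NNReal

namespace SpectralRisk

noncomputable section

/-- A spectral function: nonnegative, nondecreasing and integrable on `[0,1)` with integral `1`.
The value at the endpoint `1` is irrelevant, so unbounded spectra are allowed. -/
structure Spectrum where
  toFun : ℝ → ℝ
  nonneg : ∀ u ∈ Ico (0 : ℝ) 1, 0 ≤ toFun u
  monotoneOn : MonotoneOn toFun (Ico 0 1)
  integrableOn : IntegrableOn toFun (Ico 0 1)
  integral_eq_one : ∫ u in (0 : ℝ)..1, toFun u = 1

instance : CoeFun Spectrum (fun _ => ℝ → ℝ) := ⟨Spectrum.toFun⟩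

variable {Ω : Type*} [MeasurableSpace Ω]

/-- The Value-at-Risk `VaR_p(Y) = inf {y : P(Y ≤ y) ≥ p}`, i.e. the left-continuous quantile. -/
def VaR (P : Measure Ω) (Y : Ω → ℝ) (p : ℝ) : ℝ :=
  sInf {y : ℝ | p ≤ P.real {ω | Y ω ≤ y}}

/-- The Average Value-at-Risk `AVaR_α(Y) = (1 - α)⁻¹ ∫_α^1 VaR_u(Y) du` at level `α < 1`. -/
def AVaR (P : Measure Ω) (Y : Ω → ℝ) (α : ℝ) : ℝ :=
  1 / (1 - α) * ∫ u in α..1, VaR P Y u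

/-- `‖Y‖_σ = ρ_σ(|Y|) = ∫_0^1 σ(u) VaR_u(|Y|) du`, with values in `[0, ∞]`. -/
def riskNorm (P : Measure Ω) (σ : Spectrum) (Y : Ω → ℝ) : ℝ≥0∞ :=
  ∫⁻ u in Ioo (0 : ℝ) 1, ENNReal.ofReal (σ u * VaR P (fun ω => |Y ω|) u)

/-- The relation `|Z| ≼ η σ`:
`AVaR_α(|Z|) ≤ η / (1 - α) ∫_α^1 σ(u) du` for every `0 ≤ α < 1`. -/
def Dominated (P : Measure Ω) (σ : Spectrum) (Z : Ω → ℝ) (η : ℝ) : Prop :=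
  ∀ α ∈ Ico (0 : ℝ) 1, AVaR P (fun ω => |Z ω|) α ≤ η / (1 - α) * ∫ u in α..1, σ u

/-- The gauge `‖Z‖_σ^* = inf {η ≥ 0 : |Z| ≼ η σ}`, with values in `[0, ∞]` (`inf ∅ = ∞`). -/
def gaugeNorm (P : Measure Ω) (σ : Spectrum) (Z : Ω → ℝ) : ℝ≥0∞ :=
  ⨅ (η : ℝ≥0) (_ : Dominated P σ Z η), (η : ℝ≥0∞)

set_option linter.unusedSectionVars false

section quantiles

variable {P : Measure Ω} [IsProbabilityMeasure P] {X Y : Ω → ℝ}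

lemma VaR_congr (h : X =ᵐ[P] Y) (p : ℝ) : VaR P X p = VaR P Y p := by
  unfold VaR
  congr 1; ext y
  have : P.real {ω | X ω ≤ y} = P.real {ω | Y ω ≤ y} := by
    apply measureReal_congr
    filter_upwards [h] with ω hω
    apply propext
    change X ω ≤ y ↔ Y ω ≤ y
    rw [hω]
  simp only [mem_ofPred_eq, this]

lemma VaR_le_iff (hX : Measurable X) {p t : ℝ} (hp : 0 < p) (hp1 : p < 1) :
    VaR P X p ≤ t ↔ p ≤ P.real {ω | X ω ≤ t} := by
  have : IsProbabilityMeasure (P.map X) := Measure.isProbabilityMeasure_map hX.aemeasurable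
  have hF : ∀ y, P.real {ω | X ω ≤ y} = ProbabilityTheory.cdf (P.map X) y := by
    intro y
    rw [ProbabilityTheory.cdf_eq_real, map_measureReal_apply hX measurableSet_Iic]
    rfl
  unfold VaR
  simp only [hF]
  set F := ProbabilityTheory.cdf (P.map X)
  have hbdd : BddBelow {y | p ≤ F y} := by
    have := (ProbabilityTheory.tendsto_cdf_atBot (P.map X)).eventually (gt_mem_nhds hp)
    obtain ⟨b, hb⟩ := this.exists
    refine ⟨b, fun y hy => ?_⟩
    by_contra! hlt
    exact absurd (hy.trans (F.mono hlt.le)) (not_le.2 hb)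
  have hne : {y | p ≤ F y}.Nonempty := by
    have := (ProbabilityTheory.tendsto_cdf_atTop (P.map X)).eventually (lt_mem_nhds hp1)
    obtain ⟨b, hb⟩ := this.exists
    exact ⟨b, hb.le⟩
  refine ⟨fun h => ?_, fun h => csInf_le hbdd h⟩
  have hs : p ≤ F (sInf {y | p ≤ F y}) := by
    have hc : Tendsto F (𝓝[>] (sInf {y | p ≤ F y})) (𝓝 (F (sInf {y | p ≤ F y}))) :=
      (F.right_continuous _).tendsto.mono_left (nhdsWithin_mono _ Ioi_subset_Ici_self)
    refine ge_of_tendsto hc ?_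
    filter_upwards [self_mem_nhdsWithin] with y hy
    obtain ⟨z, hz, hzy⟩ := exists_lt_of_csInf_lt hne hy
    exact le_trans hz (F.mono hzy.le)
  exact hs.trans (F.mono h)

lemma VaR_nonneg (hX0 : ∀ ω, 0 ≤ X ω) {p : ℝ} (hp : 0 < p) : 0 ≤ VaR P X p := by
  apply Real.sInf_nonneg
  intro y hy
  by_contra! hlt
  have : {ω | X ω ≤ y} = ∅ := by
    ext ω; simp only [mem_ofPred_eq, mem_empty_iff_false, iff_false, not_le]
    exact hlt.trans_le (hX0 ω)
  rw [mem_ofPred_eq, this] at hy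
  simp at hy
  linarith

lemma VaR_mono (hX : Measurable X) (hY : Measurable Y) (h : ∀ ω, X ω ≤ Y ω) {p : ℝ}
    (hp : 0 < p) (hp1 : p < 1) : VaR P X p ≤ VaR P Y p := by
  rw [VaR_le_iff hX hp hp1]
  exact ((VaR_le_iff hY hp hp1).1 le_rfl).trans
    (measureReal_mono fun ω hω => (h ω).trans hω)

lemma VaR_monotoneOn (hX : Measurable X) : MonotoneOn (VaR P X) (Ioo 0 1) := by
  intro p hp q hq hpq
  rw [VaR_le_iff hX hp.1 hp.2]
  exact hpq.trans ((VaR_le_iff hX hq.1 hq.2).1 le_rfl)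

lemma aemeasurable_VaR (hX : Measurable X) :
    AEMeasurable (VaR P X) (volume.restrict (Ioo 0 1)) :=
  aemeasurable_restrict_of_monotoneOn measurableSet_Ioo (VaR_monotoneOn hX)

lemma aemeasurable_VaR' (hX : Measurable X) {a : ℝ} (ha : 0 ≤ a) :
    AEMeasurable (VaR P X) (volume.restrict (Ioo a 1)) :=
  (aemeasurable_VaR hX).mono_measure (Measure.restrict_mono (Ioo_subset_Ioo_left ha) le_rfl)

lemma VaR_smul (c : ℝ) (hc : 0 < c) (p : ℝ) :
    VaR P (fun ω => c * X ω) p = c * VaR P X p := by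
  unfold VaR
  rw [← smul_eq_mul c, ← Real.sInf_smul_of_nonneg hc.le]
  congr 1; ext y
  rw [Set.mem_smul_set_iff_inv_smul_mem₀ hc.ne']
  have : {ω | c * X ω ≤ y} = {ω | X ω ≤ c⁻¹ • y} := by
    ext ω
    simp only [mem_ofPred_eq, smul_eq_mul]
    rw [inv_mul_eq_div, le_div_iff₀ hc, mul_comm]
  simp only [mem_ofPred_eq, this]

lemma VaR_zero {p : ℝ} (hp : 0 < p) (hp1 : p < 1) : VaR P (fun _ => (0 : ℝ)) p = 0 := by
  apply le_antisymm _ (VaR_nonneg (fun _ => le_rfl) hp)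
  rw [VaR_le_iff measurable_const hp hp1]
  simpa using hp1.le

/-- The upper tail `∫_a^1 VaR_u(X) du` of the quantile function, for `X ≥ 0`. -/
def tail (P : Measure Ω) (X : Ω → ℝ) (a : ℝ) : ℝ≥0∞ :=
  ∫⁻ u in Ioo a 1, ENNReal.ofReal (VaR P X u)

lemma tail_eq (hX : Measurable X) (hX0 : ∀ ω, 0 ≤ X ω) {a : ℝ} (ha : 0 ≤ a) :
    tail P X a = ∫⁻ t in Ioi (0 : ℝ), min (ENNReal.ofReal (1 - a)) (P {ω | t < X ω}) := by
  unfold tail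
  rw [lintegral_eq_lintegral_meas_lt _ _ (aemeasurable_VaR' hX ha)]
  · refine setLIntegral_congr_fun measurableSet_Ioi fun t _ => ?_
    have h1 : P {ω | t < X ω} = ENNReal.ofReal (1 - P.real {ω | X ω ≤ t}) := by
      have hm : MeasurableSet {ω | X ω ≤ t} := measurableSet_le hX measurable_const
      have : {ω | t < X ω} = {ω | X ω ≤ t}ᶜ := by ext; simp
      rw [this, ← ofReal_measureReal, probReal_compl_eq_one_sub hm]
    change (volume.restrict (Ioo a 1)) {u | t < VaR P X u} = _
    rw [h1, ← ENNReal.ofReal_min, Measure.restrict_apply' measurableSet_Ioo]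
    have : {u | t < VaR P X u} ∩ Ioo a 1 = Ioo (max a (P.real {ω | X ω ≤ t})) 1 := by
      ext u
      simp only [mem_inter_iff, mem_ofPred_eq, mem_Ioo, max_lt_iff]
      constructor
      · rintro ⟨h, h2, h3⟩
        refine ⟨⟨h2, ?_⟩, h3⟩
        rwa [← not_le, VaR_le_iff hX (ha.trans_lt h2) h3, not_le] at h
      · rintro ⟨⟨h2, h⟩, h3⟩
        refine ⟨?_, h2, h3⟩
        rwa [← not_le, VaR_le_iff hX (ha.trans_lt h2) h3, not_le]
    rw [this, Real.volume_Ioo]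
    congr 1
    rcases le_total a (P.real {ω | X ω ≤ t}) with h | h
    · rw [max_eq_right h, min_eq_right (by linarith)]
    · rw [max_eq_left h, min_eq_left (by linarith)]
  · filter_upwards [ae_restrict_mem measurableSet_Ioo] with u hu
    exact VaR_nonneg hX0 (ha.trans_lt hu.1)

lemma stopLoss_eq (hX : Measurable X) {s : ℝ} :
    ∫⁻ ω, ENNReal.ofReal (X ω - s) ∂P = ∫⁻ t in Ioi s, P {ω | t < X ω} := by
  have h0 : ∫⁻ ω, ENNReal.ofReal (X ω - s) ∂P = ∫⁻ ω, ENNReal.ofReal (max (X ω - s) 0) ∂P := by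
    refine lintegral_congr fun ω => ?_
    rw [ENNReal.ofReal_max]; simp
  rw [h0, lintegral_eq_lintegral_meas_lt (f := fun ω => max (X ω - s) 0) _
    (Eventually.of_forall fun ω => le_max_right _ _)
    ((hX.sub_const s).max measurable_const).aemeasurable]
  have := (measurePreserving_add_right (volume : Measure ℝ) s).setLIntegral_comp_preimage_emb
    (measurableEmbedding_addRight s) (fun t => P {ω | t < X ω}) (Ioi s)
  rw [← this]
  have hpre : (fun x : ℝ => x + s) ⁻¹' Ioi s = Ioi 0 := by ext; simp
  rw [hpre]
  refine setLIntegral_congr_fun measurableSet_Ioi fun t ht => ?_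
  congr 1; ext ω
  have ht' : (0 : ℝ) < t := ht
  simp only [mem_ofPred_eq, lt_max_iff]
  constructor
  · rintro (h | h) <;> linarith
  · intro h; left; linarith

lemma Ioi_split {s : ℝ} (hs : 0 ≤ s) (f : ℝ → ℝ≥0∞) :
    ∫⁻ t in Ioi (0 : ℝ), f t = (∫⁻ t in Ioc 0 s, f t) + ∫⁻ t in Ioi s, f t := by
  rw [← Ioc_union_Ioi_eq_Ioi hs, lintegral_union measurableSet_Ioi]
  rw [Set.disjoint_left]
  intro x hx hx'
  exact absurd hx.2 (not_le.2 hx')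

lemma tail_le (hX : Measurable X) (hX0 : ∀ ω, 0 ≤ X ω) {a s : ℝ} (ha : 0 ≤ a)
    (hs : 0 ≤ s) :
    tail P X a ≤ ENNReal.ofReal (1 - a) * ENNReal.ofReal s
      + ∫⁻ ω, ENNReal.ofReal (X ω - s) ∂P := by
  rw [tail_eq hX hX0 ha, stopLoss_eq hX, Ioi_split hs]
  gcongr
  · calc _ ≤ ∫⁻ _ in Ioc 0 s, ENNReal.ofReal (1 - a) := lintegral_mono fun t => min_le_left _ _
      _ = _ := by simp
  · exact min_le_right _ _

lemma exists_tail (hX : Measurable X) (hX0 : ∀ ω, 0 ≤ X ω) {a : ℝ} (ha : 0 ≤ a)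
    (ha1 : a < 1) : ∃ s : ℝ, 0 ≤ s ∧ ENNReal.ofReal (1 - a) * ENNReal.ofReal s
      + ∫⁻ ω, ENNReal.ofReal (X ω - s) ∂P ≤ tail P X a := by
  have hc : ∀ t, P {ω | t < X ω} = ENNReal.ofReal (1 - P.real {ω | X ω ≤ t}) := by
    intro t
    have hm : MeasurableSet {ω | X ω ≤ t} := measurableSet_le hX measurable_const
    have : {ω | t < X ω} = {ω | X ω ≤ t}ᶜ := by ext; simp
    rw [this, ← ofReal_measureReal, probReal_compl_eq_one_sub hm]
  have key : ∃ s : ℝ, 0 ≤ s ∧ (∀ t, t < s → P.real {ω | X ω ≤ t} ≤ a ∨ t ≤ 0) ∧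
      (∀ t, s ≤ t → a ≤ P.real {ω | X ω ≤ t}) := by
    rcases ha.eq_or_lt with rfl | ha0
    · exact ⟨0, le_rfl, fun t ht => Or.inr ht.le, fun t _ => measureReal_nonneg⟩
    · refine ⟨VaR P X a, VaR_nonneg hX0 ha0, fun t ht => Or.inl ?_, fun t ht => ?_⟩
      · rw [← not_le, VaR_le_iff hX ha0 ha1, not_le] at ht
        exact ht.le
      · exact (VaR_le_iff hX ha0 ha1).1 ht
  obtain ⟨s, hs, h1, h2⟩ := key
  refine ⟨s, hs, ?_⟩
  rw [tail_eq hX hX0 ha, stopLoss_eq hX, Ioi_split hs]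
  refine add_le_add ?_ ?_
  · calc _ = ∫⁻ _ in Ioo 0 s, ENNReal.ofReal (1 - a) := by simp
      _ ≤ ∫⁻ t in Ioo 0 s, min (ENNReal.ofReal (1 - a)) (P {ω | t < X ω}) := by
          refine setLIntegral_mono' measurableSet_Ioo fun t ht => le_min le_rfl ?_
          rw [hc]
          apply ENNReal.ofReal_le_ofReal
          rcases h1 t ht.2 with h | h
          · linarith
          · exact absurd ht.1 (not_lt.2 h)
      _ ≤ _ := lintegral_mono_set Ioo_subset_Ioc_self
  · refine setLIntegral_mono' measurableSet_Ioi fun t ht => le_min ?_ le_rfl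
    rw [hc]
    apply ENNReal.ofReal_le_ofReal
    have := h2 t (le_of_lt ht)
    linarith

lemma tail_add_le (hX : Measurable X) (hX0 : ∀ ω, 0 ≤ X ω) (hY : Measurable Y)
    (hY0 : ∀ ω, 0 ≤ Y ω) {a : ℝ} (ha : 0 ≤ a) :
    tail P (fun ω => X ω + Y ω) a ≤ tail P X a + tail P Y a := by
  rcases le_or_gt 1 a with ha1 | ha1
  · simp [tail, Ioo_eq_empty (not_lt.2 ha1)]
  obtain ⟨s, hs, h1⟩ := exists_tail (P := P) hX hX0 ha ha1
  obtain ⟨r, hr, h2⟩ := exists_tail (P := P) hY hY0 ha ha1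
  refine (tail_le (hX.add hY) (fun ω => add_nonneg (hX0 ω) (hY0 ω)) ha
    (add_nonneg hs hr)).trans (le_trans ?_ (add_le_add h1 h2))
  rw [ENNReal.ofReal_add hs hr, mul_add, add_add_add_comm]
  gcongr
  rw [← lintegral_add_left (hX.sub_const s).ennreal_ofReal]
  refine lintegral_mono fun ω => ?_
  rw [show (X + Y) ω - (s + r) = (X ω - s) + (Y ω - r) by simp only [Pi.add_apply]; ring]
  exact ENNReal.ofReal_add_le

lemma tail_mono (hX : Measurable X) (hY : Measurable Y) (h : ∀ ω, X ω ≤ Y ω) {a : ℝ}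
    (ha : 0 ≤ a) : tail P X a ≤ tail P Y a :=
  setLIntegral_mono' measurableSet_Ioo fun _ hu =>
    ENNReal.ofReal_le_ofReal (VaR_mono hX hY h (ha.trans_lt hu.1) hu.2)

lemma tail_abs_add_le (hX : Measurable X) (hY : Measurable Y) {a : ℝ} (ha : 0 ≤ a) :
    tail P (fun ω => |X ω + Y ω|) a ≤ tail P (fun ω => |X ω|) a + tail P (fun ω => |Y ω|) a :=
  (tail_mono (hX.add hY).abs (hX.abs.add hY.abs) (fun _ => abs_add_le _ _) ha).trans
    (tail_add_le hX.abs (fun _ => abs_nonneg _) hY.abs (fun _ => abs_nonneg _) ha)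

lemma tail_lt_top (hX : Measurable X) (hX0 : ∀ ω, 0 ≤ X ω) (hi : Integrable X P) {a : ℝ}
    (ha : 0 ≤ a) : tail P X a < ∞ := by
  refine (tail_le hX hX0 ha le_rfl).trans_lt ?_
  simp only [ENNReal.ofReal_zero, mul_zero, zero_add, sub_zero]
  have := hi.2
  rw [hasFiniteIntegral_iff_norm] at this
  refine (lintegral_mono fun ω => ?_).trans_lt this
  exact ENNReal.ofReal_le_ofReal (Real.le_norm_self _)

lemma ae_zero_of_VaR (hX : Measurable X) (hX0 : ∀ ω, 0 ≤ X ω) {a : ℝ} (ha : 0 ≤ a)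
    (ha1 : a < 1) (h : ∀ᵐ u ∂(volume.restrict (Ioo a 1)), VaR P X u = 0) : X =ᵐ[P] 0 := by
  have h1 : 1 ≤ P.real {ω | X ω ≤ 0} := by
    refine le_of_forall_lt fun c hc => ?_
    have hne : volume (Ioo (max a c) 1) ≠ 0 := by
      rw [Real.volume_Ioo, ne_eq, ENNReal.ofReal_eq_zero, not_le, sub_pos]
      exact max_lt ha1 hc
    rw [ae_restrict_iff' measurableSet_Ioo] at h
    have hne' : ∃ᵐ u ∂volume, u ∈ Ioo (max a c) 1 := by
      rw [frequently_ae_iff]; exact hne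
    obtain ⟨u, hu, hu2⟩ := (hne'.and_eventually h).exists
    have hua : a < u := (le_max_left _ _).trans_lt hu.1
    have := (VaR_le_iff (P := P) hX (ha.trans_lt hua) hu.2).1 (hu2 ⟨hua, hu.2⟩).le
    exact ((le_max_right _ _).trans_lt hu.1).trans_le this
  have h2 : P {ω | X ω ≤ 0} = 1 := by
    apply le_antisymm prob_le_one
    rw [← ofReal_measureReal]
    simpa using ENNReal.ofReal_le_ofReal h1
  have hm : MeasurableSet {ω | X ω ≤ 0} := measurableSet_le hX measurable_const
  have h3 : ∀ᵐ ω ∂P, X ω ≤ 0 := (prob_compl_eq_zero_iff hm).2 h2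
  filter_upwards [h3] with ω hω
  exact le_antisymm hω (hX0 ω)

end quantiles

section norms

variable {P : Measure Ω} [IsProbabilityMeasure P] {X Y : Ω → ℝ} (σ : Spectrum)

lemma Spectrum.mono_Ioo : MonotoneOn σ (Ioo 0 1) :=
  σ.monotoneOn.mono Ioo_subset_Ico_self

lemma Spectrum.aemeasurable : AEMeasurable σ (volume.restrict (Ioo 0 1)) :=
  aemeasurable_restrict_of_monotoneOn measurableSet_Ioo σ.mono_Ioo

lemma Spectrum.superlevel (t : ℝ) : ∃ a : ℝ, 0 ≤ a ∧
    ({u | t < σ u} ∩ Ioo 0 1 : Set ℝ) =ᵐ[volume] Ioo a 1 := by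
  rcases ({u | t < σ u} ∩ Ioo 0 1 : Set ℝ).eq_empty_or_nonempty with h | h
  · exact ⟨1, zero_le_one, by rw [h]; simp⟩
  have hb : BddBelow ({u | t < σ u} ∩ Ioo 0 1 : Set ℝ) := ⟨0, fun u hu => hu.2.1.le⟩
  refine ⟨sInf ({u | t < σ u} ∩ Ioo 0 1), le_csInf h fun u hu => hu.2.1.le, ?_⟩
  apply Filter.EventuallyLE.antisymm
  · refine EventuallyLE.trans (LE.le.eventuallyLE (fun u hu => ?_))
      (Ioo_ae_eq_Ico.symm.le : (Ico (sInf ({u | t < σ u} ∩ Ioo 0 1)) 1 : Set ℝ) ≤ᵐ[volume] _)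
    exact ⟨csInf_le hb hu, hu.2.2⟩
  · refine LE.le.eventuallyLE (fun u hu => ?_)
    obtain ⟨v, hv, hvu⟩ := exists_lt_of_csInf_lt h hu.1
    have hu' : u ∈ Ioo (0 : ℝ) 1 := ⟨hv.2.1.trans hvu, hu.2⟩
    exact ⟨lt_of_lt_of_le hv.1 (σ.mono_Ioo hv.2 hu' hvu.le), hu'⟩

/-- The spectral norm as a mixture of tails of the quantile function. -/
lemma spectral_layer (hX : Measurable X) :
    ∫⁻ u in Ioo (0 : ℝ) 1, ENNReal.ofReal (σ u * VaR P X u)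
      = ∫⁻ t in Ioi (0 : ℝ), tail P X (σ.superlevel t).choose := by
  have hV : AEMeasurable (fun u => ENNReal.ofReal (VaR P X u)) (volume.restrict (Ioo 0 1)) :=
    (aemeasurable_VaR hX).ennreal_ofReal
  have hac := withDensity_absolutelyContinuous (volume.restrict (Ioo (0 : ℝ) 1))
    (fun u => ENNReal.ofReal (VaR P X u))
  have h := lintegral_eq_lintegral_meas_lt (f := σ)
    ((volume.restrict (Ioo (0 : ℝ) 1)).withDensity (fun u => ENNReal.ofReal (VaR P X u)))
    (hac.ae_le (by
      filter_upwards [ae_restrict_mem measurableSet_Ioo] with u hu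
      exact σ.nonneg u (Ioo_subset_Ico_self hu)))
    (σ.aemeasurable.mono' hac)
  rw [lintegral_withDensity_eq_lintegral_mul₀ hV σ.aemeasurable.ennreal_ofReal] at h
  calc _ = _ := ?_
    _ = _ := h
    _ = _ := ?_
  · refine setLIntegral_congr_fun measurableSet_Ioo fun u hu => ?_
    simp only [Pi.mul_apply]
    rw [ENNReal.ofReal_mul (σ.nonneg u (Ioo_subset_Ico_self hu)), mul_comm]
  · refine lintegral_congr fun t => ?_
    have hnull : NullMeasurableSet {u | t < σ u} (volume.restrict (Ioo (0 : ℝ) 1)) :=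
      nullMeasurableSet_lt aemeasurable_const σ.aemeasurable
    rw [withDensity_apply' , Measure.restrict_restrict₀ hnull, tail]
    exact setLIntegral_congr (σ.superlevel t).choose_spec.2

lemma tail_layer_eq (X : Ω → ℝ) (t : ℝ) : tail P X (σ.superlevel t).choose
    = ∫⁻ u in {u | t < σ u} ∩ Ioo 0 1, ENNReal.ofReal (VaR P X u) :=
  (setLIntegral_congr (σ.superlevel t).choose_spec.2).symm

lemma measurable_tail_layer (X : Ω → ℝ) :
    Measurable fun t => tail P X (σ.superlevel t).choose := by
  simp only [tail_layer_eq]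
  apply Antitone.measurable
  intro s t hst
  exact lintegral_mono_set (fun u hu => ⟨lt_of_le_of_lt hst hu.1, hu.2⟩)

lemma riskNorm_congr (h : X =ᵐ[P] Y) : riskNorm P σ X = riskNorm P σ Y := by
  have h' : (fun ω => |X ω|) =ᵐ[P] (fun ω => |Y ω|) := by
    filter_upwards [h] with ω hω
    rw [hω]
  simp only [riskNorm, VaR_congr h']

lemma riskNorm_add_le (hX : Measurable X) (hY : Measurable Y) :
    riskNorm P σ (fun ω => X ω + Y ω) ≤ riskNorm P σ X + riskNorm P σ Y := by
  have hXY : Measurable fun ω => |X ω + Y ω| := (hX.add hY).abs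
  unfold riskNorm
  rw [spectral_layer σ hXY, spectral_layer σ hX.abs, spectral_layer σ hY.abs,
    ← lintegral_add_left (measurable_tail_layer σ _)]
  exact lintegral_mono fun t => tail_abs_add_le hX hY (σ.superlevel t).choose_spec.1

lemma riskNorm_zero : riskNorm P σ (fun _ => (0 : ℝ)) = 0 := by
  unfold riskNorm
  rw [setLIntegral_congr_fun (g := fun _ => 0) measurableSet_Ioo]
  · simp
  · intro u hu
    simp [VaR_zero (P := P) hu.1 hu.2]

lemma riskNorm_smul (c : ℝ) (X : Ω → ℝ) :
    riskNorm P σ (fun ω => c * X ω) = ENNReal.ofReal |c| * riskNorm P σ X := by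
  rcases eq_or_ne c 0 with rfl | hc
  · simpa using riskNorm_zero (P := P) σ
  unfold riskNorm
  rw [← lintegral_const_mul' _ _ ENNReal.ofReal_ne_top]
  refine lintegral_congr fun u => ?_
  simp only [abs_mul]
  rw [VaR_smul _ (abs_pos.2 hc), ← ENNReal.ofReal_mul (abs_nonneg c)]
  congr 1; ring

lemma Spectrum.exists_pos : ∃ a : ℝ, 0 ≤ a ∧ a < 1 ∧ ∀ u ∈ Ioo a 1, 0 < σ u := by
  by_contra! h
  have h0 : ∀ u ∈ Ioo (0 : ℝ) 1, σ u = 0 := by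
    intro u hu
    obtain ⟨v, hv, hv0⟩ := h u hu.1.le hu.2
    have := σ.mono_Ioo hu ⟨hu.1.trans hv.1, hv.2⟩ hv.1.le
    exact le_antisymm (this.trans hv0) (σ.nonneg u (Ioo_subset_Ico_self hu))
  have := σ.integral_eq_one
  rw [intervalIntegral.integral_of_le zero_le_one, integral_Ioc_eq_integral_Ioo,
    setIntegral_congr_fun measurableSet_Ioo h0] at this
  simp at this

lemma riskNorm_eq_zero (hX : Measurable X) (h : riskNorm P σ X = 0) : X =ᵐ[P] 0 := by
  obtain ⟨a, ha, ha1, hpos⟩ := σ.exists_pos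
  have hm : AEMeasurable (fun u => ENNReal.ofReal (σ u * VaR P (fun ω => |X ω|) u))
      (volume.restrict (Ioo 0 1)) :=
    (σ.aemeasurable.mul (aemeasurable_VaR hX.abs)).ennreal_ofReal
  unfold riskNorm at h
  rw [lintegral_eq_zero_iff' hm, EventuallyEq, ae_restrict_iff' measurableSet_Ioo] at h
  have : (fun ω => |X ω|) =ᵐ[P] 0 := by
    refine ae_zero_of_VaR hX.abs (fun _ => abs_nonneg _) ha ha1 ?_
    rw [ae_restrict_iff' measurableSet_Ioo]
    filter_upwards [h] with u hu hua
    have h1 := hu ⟨ha.trans_lt hua.1, hua.2⟩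
    have h2 := hpos u hua
    simp only [Pi.zero_apply, ENNReal.ofReal_eq_zero] at h1
    exact le_antisymm (nonpos_of_mul_nonpos_right h1 h2)
      (VaR_nonneg (fun _ => abs_nonneg _) (ha.trans_lt hua.1))
  filter_upwards [this] with ω hω
  simpa using hω

lemma Spectrum.tail_nonneg {α : ℝ} (h : α ∈ Ico (0 : ℝ) 1) : 0 ≤ ∫ u in α..1, σ u := by
  rw [intervalIntegral.integral_of_le h.2.le, integral_Ioc_eq_integral_Ioo]
  exact setIntegral_nonneg measurableSet_Ioo fun u hu =>
    σ.nonneg u ⟨h.1.trans hu.1.le, hu.2⟩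

lemma dominated_iff {Z : Ω → ℝ} {η : ℝ} : Dominated P σ Z η ↔
    ∀ α ∈ Ico (0 : ℝ) 1, ∫ u in α..1, VaR P (fun ω => |Z ω|) u ≤ η * ∫ u in α..1, σ u := by
  refine forall₂_congr fun α h => ?_
  have : 0 < 1 - α := sub_pos.2 h.2
  rw [AVaR, div_mul_eq_mul_div, div_mul_eq_mul_div, one_mul, div_le_div_iff_of_pos_right this]

lemma toReal_tail (hX : Measurable X) (hX0 : ∀ ω, 0 ≤ X ω) {α : ℝ}
    (h : α ∈ Ico (0 : ℝ) 1) : (tail P X α).toReal = ∫ u in α..1, VaR P X u := by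
  rw [intervalIntegral.integral_of_le h.2.le, integral_Ioc_eq_integral_Ioo,
    integral_eq_lintegral_of_nonneg_ae, tail]
  · filter_upwards [ae_restrict_mem measurableSet_Ioo] with u hu
    exact VaR_nonneg hX0 (h.1.trans_lt hu.1)
  · exact (aemeasurable_VaR' hX h.1).aestronglyMeasurable

lemma dominated_of_gaugeNorm_le {Z : Ω → ℝ} {η : ℝ≥0} (h : gaugeNorm P σ Z ≤ η) :
    Dominated P σ Z η := by
  rw [dominated_iff]
  intro α hα
  have hS := σ.tail_nonneg hα
  have key : ∀ ε : ℝ, 0 < ε → ∫ u in α..1, VaR P (fun ω => |Z ω|) u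
      ≤ (η + ε) * ∫ u in α..1, σ u := by
    intro ε hε
    have : gaugeNorm P σ Z < ((η + ε.toNNReal : ℝ≥0) : ℝ≥0∞) := by
      refine h.trans_lt ?_
      rw [ENNReal.coe_lt_coe]
      exact lt_add_of_pos_right _ (Real.toNNReal_pos.2 hε)
    unfold gaugeNorm at this
    simp only [iInf_lt_iff] at this
    obtain ⟨η', hd, hlt⟩ := this
    refine ((dominated_iff σ).1 hd α hα).trans ?_
    gcongr
    rw [ENNReal.coe_lt_coe, ← NNReal.coe_lt_coe, NNReal.coe_add, Real.coe_toNNReal _ hε.le] at hlt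
    exact hlt.le
  have hc : Tendsto (fun ε : ℝ => ((η : ℝ) + ε) * ∫ u in α..1, σ u) (𝓝[>] 0)
      (𝓝 (η * ∫ u in α..1, σ u)) := by
    have : Continuous fun ε : ℝ => ((η : ℝ) + ε) * ∫ u in α..1, σ u := by fun_prop
    exact (this.tendsto' 0 _ (by simp)).mono_left nhdsWithin_le_nhds
  refine ge_of_tendsto hc ?_
  filter_upwards [self_mem_nhdsWithin] with ε hε
  exact key ε hε

lemma gaugeNorm_le_iff {Z : Ω → ℝ} {η : ℝ≥0} : gaugeNorm P σ Z ≤ η ↔ Dominated P σ Z η :=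
  ⟨dominated_of_gaugeNorm_le σ, fun h => iInf₂_le η h⟩

lemma dominated_congr (h : X =ᵐ[P] Y) (η : ℝ) : Dominated P σ X η ↔ Dominated P σ Y η := by
  have h' : (fun ω => |X ω|) =ᵐ[P] (fun ω => |Y ω|) := by
    filter_upwards [h] with ω hω
    rw [hω]
  simp only [dominated_iff, VaR_congr h']

lemma gaugeNorm_congr (h : X =ᵐ[P] Y) : gaugeNorm P σ X = gaugeNorm P σ Y := by
  simp only [gaugeNorm, dominated_congr σ h]

lemma gaugeNorm_add_le (hX : Measurable X) (hY : Measurable Y) (hXi : Integrable X P)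
    (hYi : Integrable Y P) :
    gaugeNorm P σ (fun ω => X ω + Y ω) ≤ gaugeNorm P σ X + gaugeNorm P σ Y := by
  rcases eq_or_ne (gaugeNorm P σ X) ∞ with h1 | h1
  · simp [h1]
  rcases eq_or_ne (gaugeNorm P σ Y) ∞ with h2 | h2
  · simp [h2]
  lift gaugeNorm P σ X to ℝ≥0 using h1 with η₁ hη₁
  lift gaugeNorm P σ Y to ℝ≥0 using h2 with η₂ hη₂
  rw [← ENNReal.coe_add, gaugeNorm_le_iff, dominated_iff]
  have d1 := (dominated_iff σ).1 ((gaugeNorm_le_iff σ).1 hη₁.ge)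
  have d2 := (dominated_iff σ).1 ((gaugeNorm_le_iff σ).1 hη₂.ge)
  intro α hα
  rw [NNReal.coe_add, add_mul]
  refine le_trans ?_ (add_le_add (d1 α hα) (d2 α hα))
  have hXY : Measurable fun ω => |X ω + Y ω| := (hX.add hY).abs
  have t1 := tail_lt_top hX.abs (fun _ => abs_nonneg _) hXi.abs hα.1
  have t2 := tail_lt_top hY.abs (fun _ => abs_nonneg _) hYi.abs hα.1
  rw [← toReal_tail hX.abs (fun _ => abs_nonneg _) hα,
    ← toReal_tail hY.abs (fun _ => abs_nonneg _) hα,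
    ← toReal_tail hXY (fun _ => abs_nonneg _) hα,
    ← ENNReal.toReal_add t1.ne t2.ne]
  exact ENNReal.toReal_mono (ENNReal.add_lt_top.2 ⟨t1, t2⟩).ne (tail_abs_add_le hX hY hα.1)

lemma gaugeNorm_zero : gaugeNorm P σ (fun _ => (0 : ℝ)) = 0 := by
  rw [← nonpos_iff_eq_zero, ← ENNReal.coe_zero, gaugeNorm_le_iff, dominated_iff]
  intro α hα
  rw [intervalIntegral.integral_of_le hα.2.le, integral_Ioc_eq_integral_Ioo,
    setIntegral_congr_fun (g := fun _ => (0 : ℝ)) measurableSet_Ioo]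
  · simp
  · intro u hu
    simp [VaR_zero (P := P) (hα.1.trans_lt hu.1) hu.2]

lemma gaugeNorm_smul_le {c : ℝ} (hc : c ≠ 0) (X : Ω → ℝ) :
    gaugeNorm P σ (fun ω => c * X ω) ≤ ENNReal.ofReal |c| * gaugeNorm P σ X := by
  rcases eq_or_ne (gaugeNorm P σ X) ∞ with h1 | h1
  · rw [h1, ENNReal.mul_top (by simpa using hc)]
    exact le_top
  lift gaugeNorm P σ X to ℝ≥0 using h1 with η hη
  have d := (dominated_iff σ).1 ((gaugeNorm_le_iff σ).1 hη.ge)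
  rw [ENNReal.ofReal, ← ENNReal.coe_mul, gaugeNorm_le_iff, dominated_iff]
  intro α hα
  rw [NNReal.coe_mul, Real.coe_toNNReal _ (abs_nonneg c), mul_assoc]
  simp only [abs_mul, VaR_smul _ (abs_pos.2 hc), intervalIntegral.integral_const_mul]
  exact mul_le_mul_of_nonneg_left (d α hα) (abs_nonneg c)

lemma gaugeNorm_smul (c : ℝ) (X : Ω → ℝ) :
    gaugeNorm P σ (fun ω => c * X ω) = ENNReal.ofReal |c| * gaugeNorm P σ X := by
  rcases eq_or_ne c 0 with rfl | hc
  · simpa using gaugeNorm_zero (P := P) σ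
  refine le_antisymm (gaugeNorm_smul_le σ hc X) ?_
  have h := gaugeNorm_smul_le (P := P) σ (inv_ne_zero hc) (fun ω => c * X ω)
  simp only [inv_mul_cancel_left₀ hc] at h
  calc _ ≤ ENNReal.ofReal |c| * (ENNReal.ofReal |c⁻¹| * gaugeNorm P σ (fun ω => c * X ω)) := by
        gcongr
    _ = _ := by
        rw [← mul_assoc, ← ENNReal.ofReal_mul (abs_nonneg c), ← abs_mul, mul_inv_cancel₀ hc]
        simp

lemma gaugeNorm_eq_zero (hX : Measurable X) (hXi : Integrable X P)
    (h : gaugeNorm P σ X = 0) : X =ᵐ[P] 0 := by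
  have d := (dominated_iff σ).1 ((gaugeNorm_le_iff (η := 0) σ).1 (h.le.trans zero_le))
  have h0 : (0 : ℝ) ∈ Ico (0 : ℝ) 1 := ⟨le_rfl, zero_lt_one⟩
  have d0 := d 0 h0
  have t := tail_lt_top hX.abs (fun _ => abs_nonneg _) hXi.abs (le_refl (0 : ℝ))
  rw [← toReal_tail hX.abs (fun _ => abs_nonneg _) h0, NNReal.coe_zero, zero_mul] at d0
  have t0 : tail P (fun ω => |X ω|) 0 = 0 := by
    have := le_antisymm d0 ENNReal.toReal_nonneg
    exact ((ENNReal.toReal_eq_zero_iff _).1 this).resolve_right t.ne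
  rw [tail, lintegral_eq_zero_iff' (aemeasurable_VaR hX.abs).ennreal_ofReal] at t0
  have : (fun ω => |X ω|) =ᵐ[P] 0 := by
    refine ae_zero_of_VaR hX.abs (fun _ => abs_nonneg _) le_rfl zero_lt_one ?_
    filter_upwards [t0, ae_restrict_mem measurableSet_Ioo] with u hu hu1
    simp only [Pi.zero_apply, ENNReal.ofReal_eq_zero] at hu
    exact le_antisymm hu (VaR_nonneg (fun _ => abs_nonneg _) hu1.1)
  filter_upwards [this] with ω hω
  simpa using hω

end norms

section spaces

variable (P : Measure Ω) [IsProbabilityMeasure P] (σ : Spectrum)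

lemma riskNorm_coe_add_le (X Y : Ω →ₘ[P] ℝ) : riskNorm P σ (X + Y : Ω →ₘ[P] ℝ)
    ≤ riskNorm P σ X + riskNorm P σ Y := by
  rw [riskNorm_congr σ (AEEqFun.coeFn_add X Y)]
  exact riskNorm_add_le σ X.measurable Y.measurable

lemma riskNorm_coe_smul (c : ℝ) (X : Ω →ₘ[P] ℝ) : riskNorm P σ (c • X : Ω →ₘ[P] ℝ)
    = ENNReal.ofReal |c| * riskNorm P σ X := by
  rw [riskNorm_congr σ (AEEqFun.coeFn_smul c X)]
  exact riskNorm_smul σ c X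

lemma riskNorm_coe_zero : riskNorm P σ (0 : Ω →ₘ[P] ℝ) = 0 := by
  rw [riskNorm_congr σ AEEqFun.coeFn_zero]
  exact riskNorm_zero σ

lemma gaugeNorm_coe_add_le {X Y : Ω →ₘ[P] ℝ} (hX : Integrable X P) (hY : Integrable Y P) :
    gaugeNorm P σ (X + Y : Ω →ₘ[P] ℝ) ≤ gaugeNorm P σ X + gaugeNorm P σ Y := by
  rw [gaugeNorm_congr σ (AEEqFun.coeFn_add X Y)]
  exact gaugeNorm_add_le σ X.measurable Y.measurable hX hY

lemma gaugeNorm_coe_smul (c : ℝ) (X : Ω →ₘ[P] ℝ) : gaugeNorm P σ (c • X : Ω →ₘ[P] ℝ)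
    = ENNReal.ofReal |c| * gaugeNorm P σ X := by
  rw [gaugeNorm_congr σ (AEEqFun.coeFn_smul c X)]
  exact gaugeNorm_smul σ c X

lemma gaugeNorm_coe_zero : gaugeNorm P σ (0 : Ω →ₘ[P] ℝ) = 0 := by
  rw [gaugeNorm_congr σ AEEqFun.coeFn_zero]
  exact gaugeNorm_zero σ

/-- The natural domain `L_σ = {Y ∈ L⁰ : ‖Y‖_σ < ∞}`; random variables that agree almost surely
are identified. -/
def NaturalDomain : Submodule ℝ (Ω →ₘ[P] ℝ) where
  carrier := {Y | riskNorm P σ Y < ∞}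
  zero_mem' := by
    change riskNorm P σ (0 : Ω →ₘ[P] ℝ) < ∞
    rw [riskNorm_coe_zero]
    exact ENNReal.zero_lt_top
  add_mem' {X Y} hX hY :=
    (riskNorm_coe_add_le P σ X Y).trans_lt (ENNReal.add_lt_top.2 ⟨hX, hY⟩)
  smul_mem' c X hX := by
    change riskNorm P σ (c • X : Ω →ₘ[P] ℝ) < ∞
    rw [riskNorm_coe_smul]
    exact ENNReal.mul_lt_top ENNReal.ofReal_lt_top hX

/-- The space `L_σ^* = {Z ∈ L¹ : ‖Z‖_σ^* < ∞}`; random variables that agree almost surely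
are identified. -/
def GaugeDomain : Submodule ℝ (Ω →ₘ[P] ℝ) where
  carrier := {Z | Integrable Z P ∧ gaugeNorm P σ Z < ∞}
  zero_mem' := by
    refine ⟨(integrable_zero Ω ℝ P).congr AEEqFun.coeFn_zero.symm, ?_⟩
    rw [gaugeNorm_coe_zero]
    exact ENNReal.zero_lt_top
  add_mem' {X Y} hX hY :=
    ⟨(hX.1.add hY.1).congr (AEEqFun.coeFn_add X Y).symm,
      (gaugeNorm_coe_add_le P σ hX.1 hY.1).trans_lt (ENNReal.add_lt_top.2 ⟨hX.2, hY.2⟩)⟩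
  smul_mem' c X hX := by
    refine ⟨(hX.1.smul c).congr (AEEqFun.coeFn_smul c X).symm, ?_⟩
    rw [gaugeNorm_coe_smul]
    exact ENNReal.mul_lt_top ENNReal.ofReal_lt_top hX.2

instance : Norm (NaturalDomain P σ) := ⟨fun Y => (riskNorm P σ (Y : Ω →ₘ[P] ℝ)).toReal⟩

instance : Norm (GaugeDomain P σ) := ⟨fun Z => (gaugeNorm P σ (Z : Ω →ₘ[P] ℝ)).toReal⟩

lemma NaturalDomain.core : NormedSpace.Core ℝ (NaturalDomain P σ) where
  norm_nonneg _ := ENNReal.toReal_nonneg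
  norm_smul c X := by
    change (riskNorm P σ (c • (X : Ω →ₘ[P] ℝ) : Ω →ₘ[P] ℝ)).toReal
      = ‖c‖ * (riskNorm P σ (X : Ω →ₘ[P] ℝ)).toReal
    rw [riskNorm_coe_smul, ENNReal.toReal_mul, ENNReal.toReal_ofReal (abs_nonneg c),
      Real.norm_eq_abs]
  norm_triangle X Y := by
    have hX : riskNorm P σ (X : Ω →ₘ[P] ℝ) < ∞ := X.2
    have hY : riskNorm P σ (Y : Ω →ₘ[P] ℝ) < ∞ := Y.2
    change (riskNorm P σ ((X : Ω →ₘ[P] ℝ) + (Y : Ω →ₘ[P] ℝ) : Ω →ₘ[P] ℝ)).toReal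
      ≤ (riskNorm P σ (X : Ω →ₘ[P] ℝ)).toReal + (riskNorm P σ (Y : Ω →ₘ[P] ℝ)).toReal
    rw [← ENNReal.toReal_add hX.ne hY.ne]
    exact ENNReal.toReal_mono (ENNReal.add_lt_top.2 ⟨hX, hY⟩).ne (riskNorm_coe_add_le P σ _ _)
  norm_eq_zero_iff X := by
    have hX : riskNorm P σ (X : Ω →ₘ[P] ℝ) < ∞ := X.2
    change (riskNorm P σ (X : Ω →ₘ[P] ℝ)).toReal = 0 ↔ _
    constructor
    · intro h
      have h0 := ((ENNReal.toReal_eq_zero_iff _).1 h).resolve_right hX.ne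
      apply Subtype.ext
      exact AEEqFun.ext ((riskNorm_eq_zero σ X.1.measurable h0).trans
        AEEqFun.coeFn_zero.symm)
    · rintro rfl
      rw [Submodule.coe_zero, riskNorm_coe_zero, ENNReal.toReal_zero]

lemma GaugeDomain.core : NormedSpace.Core ℝ (GaugeDomain P σ) where
  norm_nonneg _ := ENNReal.toReal_nonneg
  norm_smul c X := by
    change (gaugeNorm P σ (c • (X : Ω →ₘ[P] ℝ) : Ω →ₘ[P] ℝ)).toReal
      = ‖c‖ * (gaugeNorm P σ (X : Ω →ₘ[P] ℝ)).toReal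
    rw [gaugeNorm_coe_smul, ENNReal.toReal_mul, ENNReal.toReal_ofReal (abs_nonneg c),
      Real.norm_eq_abs]
  norm_triangle X Y := by
    have hX : gaugeNorm P σ (X : Ω →ₘ[P] ℝ) < ∞ := X.2.2
    have hY : gaugeNorm P σ (Y : Ω →ₘ[P] ℝ) < ∞ := Y.2.2
    change (gaugeNorm P σ ((X : Ω →ₘ[P] ℝ) + (Y : Ω →ₘ[P] ℝ) : Ω →ₘ[P] ℝ)).toReal
      ≤ (gaugeNorm P σ (X : Ω →ₘ[P] ℝ)).toReal + (gaugeNorm P σ (Y : Ω →ₘ[P] ℝ)).toReal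
    rw [← ENNReal.toReal_add hX.ne hY.ne]
    exact ENNReal.toReal_mono (ENNReal.add_lt_top.2 ⟨hX, hY⟩).ne
      (gaugeNorm_coe_add_le P σ X.2.1 Y.2.1)
  norm_eq_zero_iff X := by
    have hX : gaugeNorm P σ (X : Ω →ₘ[P] ℝ) < ∞ := X.2.2
    change (gaugeNorm P σ (X : Ω →ₘ[P] ℝ)).toReal = 0 ↔ _
    constructor
    · intro h
      have h0 := ((ENNReal.toReal_eq_zero_iff _).1 h).resolve_right hX.ne
      apply Subtype.ext
      exact AEEqFun.ext ((gaugeNorm_eq_zero σ X.1.measurable X.2.1 h0).trans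
        AEEqFun.coeFn_zero.symm)
    · rintro rfl
      rw [Submodule.coe_zero, gaugeNorm_coe_zero, ENNReal.toReal_zero]

instance : NormedAddCommGroup (NaturalDomain P σ) :=
  NormedAddCommGroup.ofCore (NaturalDomain.core P σ)

instance : NormedSpace ℝ (NaturalDomain P σ) :=
  NormedSpace.ofCore (NaturalDomain.core P σ)

instance : NormedAddCommGroup (GaugeDomain P σ) :=
  NormedAddCommGroup.ofCore (GaugeDomain.core P σ)

instance : NormedSpace ℝ (GaugeDomain P σ) :=
  NormedSpace.ofCore (GaugeDomain.core P σ)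

end spaces

end

end SpectralRisk

/-! Write `S(a) = ∫_a^1 σ`. Everything rests on reading both norms through this one decreasing
concave function.

By the layer-cake formula `‖Y‖_σ = ∫_0^∞ S(P(|Y| ≤ t)) dt` (`riskNorm_eq_lintegral_upperTail`); in
particular `‖1_A‖_σ = S(1 - P(A))`. The relation `|Z| ≼ η σ` says that the upper quantile tails of
`|Z|` are at most `η S`. Among events of given probability, the integral of `|Z|` is bounded by such
a tail, so integrating `E[|Z|; |Y| > t]` over `t` gives the Hölder inequality
(`lintegral_mul_le_of_dominated`).

Conversely, let `ζ` be a continuous functional. Since `S(a) → 0` as `a → 1`, the set function `A ↦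
ζ(1_A)` is countably additive and vanishes on null sets, hence has a density `Z`. Testing `ζ` on
`sgn(Z) 1_A` yields `E[|Z|; A] ≤ ‖ζ‖ S(1 - P(A))` for every event `A`. Concavity of `S` turns these
bounds into `|Z| ≼ ‖ζ‖ σ`, even when `P` has atoms (`dominated_of_setIntegral_le`). The same
argument applied to `Y ↦ E YZ` gives the isometry. Density of simple functions in `L_σ`, a dominated
convergence statement, shows that `Z` represents `ζ` on all of `L_σ` (`dual_ext`). -/

namespace SpectralRisk

/-! ### The tail integral of the spectrum: limit at 1 and concavity. -/

section analysis

variable {Ω : Type*} [MeasurableSpace Ω] {P : Measure Ω} [IsProbabilityMeasure P]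
  {X Y Z : Ω → ℝ} (σ : Spectrum)

/-- The upper tail `∫_a^1 σ(u) du` of a spectrum as an extended nonnegative number. -/
noncomputable def Spectrum.upperTail (a : ℝ) : ℝ≥0∞ :=
  ∫⁻ u in Ioo a 1, ENNReal.ofReal (σ u)

lemma Spectrum.upperTail_antitone : Antitone σ.upperTail := fun _ _ h =>
  lintegral_mono_set (Ioo_subset_Ioo_left h)

lemma Spectrum.upperTail_one : σ.upperTail 1 = 0 := by simp [Spectrum.upperTail]

lemma Spectrum.intervalIntegrable {a b : ℝ} (ha : a ∈ Icc (0 : ℝ) 1) (hb : b ∈ Icc (0 : ℝ) 1) :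
    IntervalIntegrable σ volume a b := by
  have h01 : IntervalIntegrable σ volume 0 1 := by
    rw [intervalIntegrable_iff_integrableOn_Ico_of_le zero_le_one]
    exact σ.integrableOn
  refine h01.mono_set ?_
  rw [uIcc_of_le zero_le_one]
  exact uIcc_subset_Icc ha hb

lemma Spectrum.upperTail_eq {a : ℝ} (ha : a ∈ Icc (0 : ℝ) 1) :
    σ.upperTail a = ENNReal.ofReal (∫ u in a..1, σ u) := by
  rw [intervalIntegral.integral_of_le ha.2, integral_Ioc_eq_integral_Ioo,
    ofReal_integral_eq_lintegral_ofReal, Spectrum.upperTail]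
  · exact σ.integrableOn.mono_set fun u hu => ⟨ha.1.trans hu.1.le, hu.2⟩
  · filter_upwards [ae_restrict_mem measurableSet_Ioo] with u hu
    exact σ.nonneg u ⟨ha.1.trans hu.1.le, hu.2⟩

lemma Spectrum.upperTail_zero : σ.upperTail 0 = 1 := by
  rw [σ.upperTail_eq ⟨le_rfl, zero_le_one⟩, σ.integral_eq_one, ENNReal.ofReal_one]

lemma Spectrum.upperTail_le_one {a : ℝ} (ha : 0 ≤ a) : σ.upperTail a ≤ 1 :=
  (σ.upperTail_antitone ha).trans_eq σ.upperTail_zero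

lemma Spectrum.upperTail_ne_top {a : ℝ} (ha : 0 ≤ a) : σ.upperTail a ≠ ∞ :=
  ((σ.upperTail_le_one ha).trans_lt ENNReal.one_lt_top).ne

/-- Absolute continuity of the integral of `σ`: the intervals `(a i, 1)` shrink to measure zero.
Both countable additivity and dominated convergence in `L_σ` come from this limit. -/
lemma Spectrum.tendsto_upperTail {ι : Type*} {l : Filter ι} {a : ι → ℝ} (ha0 : ∀ i, 0 ≤ a i)
    (ha : Tendsto a l (𝓝 1)) : Tendsto (fun i => σ.upperTail (a i)) l (𝓝 0) := by
  have h0 : ∫⁻ u in Ioo (0 : ℝ) 1, ENNReal.ofReal (σ u) ≠ ∞ := σ.upperTail_ne_top le_rfl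
  have h1 : Tendsto (volume.restrict (Ioo (0 : ℝ) 1) ∘ fun i => Ioo (a i) 1) l (𝓝 0) := by
    have h2 : Tendsto (fun i => ENNReal.ofReal (1 - a i)) l (𝓝 0) := by
      have := ENNReal.tendsto_ofReal (tendsto_const_nhds (x := (1 : ℝ)).sub ha)
      simpa using this
    refine tendsto_of_tendsto_of_tendsto_of_le_of_le tendsto_const_nhds h2
      (fun _ => zero_le) fun i => ?_
    refine (Measure.restrict_apply_le _ _).trans ?_
    rw [Real.volume_Ioo]
  refine (tendsto_setLIntegral_zero h0 h1).congr fun i => ?_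
  rw [Measure.restrict_restrict measurableSet_Ioo,
    inter_eq_left.2 (Ioo_subset_Ioo_left (ha0 i))]
  rfl

/-- The value `σ(α)` is a supergradient at `α` of the concave function `a ↦ ∫_a^1 σ`. -/
lemma Spectrum.integral_le_supergradient {a α : ℝ} (ha : a ∈ Icc (0 : ℝ) 1)
    (hα : α ∈ Ico (0 : ℝ) 1) :
    ∫ u in a..1, σ u ≤ (∫ u in α..1, σ u) - (a - α) * σ α := by
  have hα' : α ∈ Icc (0 : ℝ) 1 := ⟨hα.1, hα.2.le⟩
  have hone : (1 : ℝ) ∈ Icc (0 : ℝ) 1 := ⟨zero_le_one, le_rfl⟩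
  have hadd := intervalIntegral.integral_add_adjacent_intervals
    (σ.intervalIntegrable ha hα') (σ.intervalIntegrable hα' hone)
  have key : ∫ u in a..α, σ u ≤ ∫ _ in a..α, σ α := by
    rcases le_total a α with h | h
    · refine intervalIntegral.integral_mono_on h (σ.intervalIntegrable ha hα')
        intervalIntegrable_const fun u hu => ?_
      exact σ.monotoneOn ⟨ha.1.trans hu.1, hu.2.trans_lt hα.2⟩ hα hu.2
    · rw [intervalIntegral.integral_symm, intervalIntegral.integral_symm α a, neg_le_neg_iff]
      -- Only interior points are compared, because `a = 1` is allowed and `σ` is controlled only on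
      -- `[0,1)`.
      refine intervalIntegral.integral_mono_on_of_le_Ioo h intervalIntegrable_const
        (σ.intervalIntegrable hα' ha) fun u hu => ?_
      exact σ.monotoneOn hα ⟨hα.1.trans hu.1.le, hu.2.trans_le ha.2⟩ hu.1.le
  rw [intervalIntegral.integral_const, smul_eq_mul] at key
  linarith

/-! ### The spectral norm in terms of the distribution function. -/

/-- Layer cake for the quantile function under the measure `σ(u) du`: the quantile at `u` exceeds
`t` exactly when `u > P(|Y| ≤ t)`. Quantiles thereby disappear from the norm. -/
lemma riskNorm_eq_lintegral_upperTail (hY : Measurable Y) :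
    riskNorm P σ Y = ∫⁻ t in Ioi (0 : ℝ), σ.upperTail (P.real {ω | |Y ω| ≤ t}) := by
  have hσ : AEMeasurable (fun u => ENNReal.ofReal (σ u)) (volume.restrict (Ioo (0 : ℝ) 1)) :=
    σ.aemeasurable.ennreal_ofReal
  have hV := aemeasurable_VaR (P := P) hY.abs
  have hac := withDensity_absolutelyContinuous (volume.restrict (Ioo (0 : ℝ) 1))
    (fun u => ENNReal.ofReal (σ u))
  have h := lintegral_eq_lintegral_meas_lt (f := VaR P (fun ω => |Y ω|))
    ((volume.restrict (Ioo (0 : ℝ) 1)).withDensity (fun u => ENNReal.ofReal (σ u)))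
    (hac.ae_le (by
      filter_upwards [ae_restrict_mem measurableSet_Ioo] with u hu
      exact VaR_nonneg (fun _ => abs_nonneg _) hu.1))
    (hV.mono' hac)
  rw [lintegral_withDensity_eq_lintegral_mul₀ hσ hV.ennreal_ofReal] at h
  calc riskNorm P σ Y = _ := ?_
    _ = _ := h
    _ = _ := ?_
  · refine setLIntegral_congr_fun measurableSet_Ioo fun u hu => ?_
    simp only [Pi.mul_apply]
    rw [ENNReal.ofReal_mul (σ.nonneg u (Ioo_subset_Ico_self hu))]
  · refine lintegral_congr fun t => ?_
    have hnull : NullMeasurableSet {u | t < VaR P (fun ω => |Y ω|) u}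
        (volume.restrict (Ioo (0 : ℝ) 1)) :=
      nullMeasurableSet_lt aemeasurable_const hV
    rw [withDensity_apply', Measure.restrict_restrict₀ hnull, Spectrum.upperTail]
    congr 2
    ext u
    simp only [mem_inter_iff, mem_ofPred_eq, mem_Ioo]
    constructor
    · rintro ⟨h, h2, h3⟩
      rw [← not_le, VaR_le_iff hY.abs h2 h3, not_le] at h
      exact ⟨h, h3⟩
    · rintro ⟨h, h3⟩
      have h2 : 0 < u := measureReal_nonneg.trans_lt h
      refine ⟨?_, h2, h3⟩
      rwa [← not_le, VaR_le_iff hY.abs h2 h3, not_le]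

lemma riskNorm_le_of_abs_le (hY : Measurable Y) {C : ℝ} (h : ∀ ω, |Y ω| ≤ C) :
    riskNorm P σ Y ≤ ENNReal.ofReal C := by
  calc riskNorm P σ Y = ∫⁻ t in Ioi (0 : ℝ), σ.upperTail (P.real {ω | |Y ω| ≤ t}) :=
        riskNorm_eq_lintegral_upperTail σ hY
    _ ≤ ∫⁻ t in Ioi (0 : ℝ), (Iio C).indicator 1 t := by
        refine lintegral_mono fun t => ?_
        by_cases ht : t < C
        · rw [indicator_of_mem (mem_Iio.2 ht)]
          exact σ.upperTail_le_one measureReal_nonneg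
        · have : {ω | |Y ω| ≤ t} = univ := eq_univ_of_forall fun ω =>
            (h ω).trans (not_lt.1 ht)
          rw [this, probReal_univ, σ.upperTail_one]
          exact zero_le
    _ = ENNReal.ofReal C := by
        rw [lintegral_indicator_one measurableSet_Iio,
          Measure.restrict_apply measurableSet_Iio, Iio_inter_Ioi, Real.volume_Ioo, sub_zero]

/-- Only `|Y|` is prescribed, so that signed indicators such as `sgn(Z) 1_A` are covered too. -/
lemma riskNorm_of_abs_eq_indicator (hY : Measurable Y) {A : Set Ω} (hA : MeasurableSet A)
    (h : ∀ ω, |Y ω| = A.indicator 1 ω) : riskNorm P σ Y = σ.upperTail (1 - P.real A) := by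
  rw [riskNorm_eq_lintegral_upperTail σ hY]
  calc _ = ∫⁻ t in Ioi (0 : ℝ),
        (Iio (1 : ℝ)).indicator (fun _ => σ.upperTail (1 - P.real A)) t := by
        refine setLIntegral_congr_fun measurableSet_Ioi fun t ht => ?_
        have ht0 : (0 : ℝ) < t := ht
        simp only [h]
        by_cases ht1 : t < 1
        · rw [indicator_of_mem (mem_Iio.2 ht1), ← probReal_compl_eq_one_sub hA]
          congr 2
          ext ω
          by_cases hω : ω ∈ A <;> simp [hω, ht0.le, ht1]
        · have : {ω | A.indicator (1 : Ω → ℝ) ω ≤ t} = univ := by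
            refine eq_univ_of_forall fun ω => ?_
            by_cases hω : ω ∈ A <;> simp [hω, ht0.le, not_lt.1 ht1]
          rw [this, probReal_univ, σ.upperTail_one, indicator_of_notMem (mt mem_Iio.1 ht1)]
    _ = _ := by
        rw [lintegral_indicator_const measurableSet_Iio,
          Measure.restrict_apply measurableSet_Iio, Iio_inter_Ioi, Real.volume_Ioo]
        simp

/-- Dominated convergence in `t`: pointwise convergence implies convergence in probability, so `P(|Y
n| ≤ t) → 1` for each `t > 0` and the integrand tends to zero, dominated by the integrand of `X`. -/
lemma tendsto_riskNorm_zero {Y : ℕ → Ω → ℝ} (hY : ∀ n, Measurable (Y n)) (hX : Measurable X)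
    (hXfin : riskNorm P σ X < ∞) (hle : ∀ n ω, |Y n ω| ≤ |X ω|)
    (hlim : ∀ ω, Tendsto (fun n => Y n ω) atTop (𝓝 0)) :
    Tendsto (fun n => riskNorm P σ (Y n)) atTop (𝓝 0) := by
  simp only [fun n => riskNorm_eq_lintegral_upperTail (P := P) σ (hY n)]
  rw [riskNorm_eq_lintegral_upperTail σ hX] at hXfin
  have hz : ∫⁻ _ in Ioi (0 : ℝ), (0 : ℝ≥0∞) = 0 := lintegral_zero
  rw [← hz]
  refine tendsto_lintegral_of_dominated_convergence _ (fun n => ?_) (fun n => ?_) hXfin.ne ?_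
  · refine Antitone.measurable fun s t hst => σ.upperTail_antitone ?_
    exact measureReal_mono fun ω hω => le_trans hω hst
  · exact Eventually.of_forall fun t => σ.upperTail_antitone
      (measureReal_mono fun ω hω => (hle n ω).trans hω)
  · filter_upwards [ae_restrict_mem measurableSet_Ioi] with t ht
    refine σ.tendsto_upperTail (fun _ => measureReal_nonneg) ?_
    have h := tendstoInMeasure_of_tendsto_ae (μ := P) (f := Y) (g := 0)
      (fun n => (hY n).aestronglyMeasurable) (Eventually.of_forall hlim)
    have h1 := (ENNReal.tendsto_toReal ENNReal.zero_ne_top).comp (h (ENNReal.ofReal t)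
      (ENNReal.ofReal_pos.2 ht))
    have h2 := (tendsto_const_nhds (x := (1 : ℝ))).sub h1
    rw [ENNReal.toReal_zero, sub_zero] at h2
    refine tendsto_of_tendsto_of_tendsto_of_le_of_le h2 tendsto_const_nhds (fun n => ?_)
      fun n => measureReal_le_one
    have hm : MeasurableSet {ω | |Y n ω| ≤ t} := measurableSet_le (hY n).abs measurable_const
    have h3 := probReal_compl_eq_one_sub (μ := P) hm
    have h4 : P.real {ω | |Y n ω| ≤ t}ᶜ
        ≤ P.real {ω | ENNReal.ofReal t ≤ edist (Y n ω) ((0 : Ω → ℝ) ω)} := by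
      refine measureReal_mono fun ω hω => ?_
      have hω' : t < |Y n ω| := not_le.1 hω
      change ENNReal.ofReal t ≤ edist (Y n ω) 0
      rw [edist_dist, Real.dist_eq, sub_zero]
      exact ENNReal.ofReal_le_ofReal hω'.le
    change 1 - P.real _ ≤ P.real _
    linarith

/-! ### The Hölder inequality. -/

/-- An event of probability `P(A)` captures at most the top `P(A)` share of the quantile mass: `P(A
∩ {t < X})` is at most both `P(A)` and `P(t < X)`, and the tail integrates their minimum. -/
lemma setLIntegral_le_tail (hX : Measurable X) (hX0 : ∀ ω, 0 ≤ X ω) (A : Set Ω) :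
    ∫⁻ ω in A, ENNReal.ofReal (X ω) ∂P ≤ tail P X (1 - P.real A) := by
  rw [tail_eq hX hX0 (sub_nonneg.2 measureReal_le_one), sub_sub_cancel, ofReal_measureReal,
    lintegral_eq_lintegral_meas_lt _ (Eventually.of_forall hX0) hX.aemeasurable]
  refine lintegral_mono fun t => le_min ?_ (Measure.restrict_apply_le _ _)
  exact (measure_mono (subset_univ _)).trans_eq (Measure.restrict_apply_univ A)

lemma tail_le_of_dominated (hZ : Measurable Z) (hZi : Integrable Z P) {η : ℝ≥0}
    (h : Dominated P σ Z η) {a : ℝ} (ha : a ∈ Icc (0 : ℝ) 1) :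
    tail P (fun ω => |Z ω|) a ≤ η * σ.upperTail a := by
  -- Domination speaks only of levels below 1; at level 1 the tail vanishes.
  rcases ha.2.eq_or_lt with rfl | ha1
  · simp [tail]
  have ha' : a ∈ Ico (0 : ℝ) 1 := ⟨ha.1, ha1⟩
  have h1 := (dominated_iff σ).1 h a ha'
  rw [← toReal_tail hZ.abs (fun _ => abs_nonneg _) ha'] at h1
  rw [σ.upperTail_eq ha, ← ENNReal.ofReal_coe_nnreal, ← ENNReal.ofReal_mul (NNReal.coe_nonneg η)]
  rw [← ENNReal.ofReal_toReal (tail_lt_top hZ.abs (fun _ => abs_nonneg _) hZi.abs ha.1).ne]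
  exact ENNReal.ofReal_le_ofReal h1

lemma lintegral_mul_le_of_dominated (hY : Measurable Y) (hZ : Measurable Z)
    (hZi : Integrable Z P) {η : ℝ≥0} (h : Dominated P σ Z η) :
    ∫⁻ ω, ENNReal.ofReal |Y ω * Z ω| ∂P ≤ riskNorm P σ Y * η := by
  have hZm : Measurable fun ω => ENNReal.ofReal |Z ω| := hZ.abs.ennreal_ofReal
  have hl := lintegral_eq_lintegral_meas_lt (f := fun ω => |Y ω|)
    (P.withDensity fun ω => ENNReal.ofReal |Z ω|)
    (Eventually.of_forall fun _ => abs_nonneg _) hY.abs.aemeasurable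
  rw [lintegral_withDensity_eq_lintegral_mul _ hZm hY.abs.ennreal_ofReal] at hl
  -- Layer cake for `|Y|` under the measure with density `|Z|`; each level set `{t < |Y|}` is then
  -- estimated by the tail of `|Z|`.
  calc _ = _ := ?_
    _ = _ := hl
    _ ≤ ∫⁻ t in Ioi (0 : ℝ), η * σ.upperTail (P.real {ω | |Y ω| ≤ t}) := ?_
    _ = _ := by
        rw [lintegral_const_mul' _ _ ENNReal.coe_ne_top, riskNorm_eq_lintegral_upperTail σ hY,
          mul_comm]
  · refine lintegral_congr fun ω => ?_
    rw [Pi.mul_apply, abs_mul, mul_comm, ENNReal.ofReal_mul (abs_nonneg _)]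
  · refine lintegral_mono fun t => ?_
    have hm : MeasurableSet {ω | t < |Y ω|} := measurableSet_lt measurable_const hY.abs
    have hc : P.real {ω | |Y ω| ≤ t} = 1 - P.real {ω | t < |Y ω|} := by
      rw [← probReal_compl_eq_one_sub hm]
      congr 1; ext ω; simp
    simp only [withDensity_apply _ hm, hc]
    exact (setLIntegral_le_tail hZ.abs (fun _ => abs_nonneg _) _).trans
      (tail_le_of_dominated σ hZ hZi h
        ⟨sub_nonneg.2 measureReal_le_one, sub_le_self _ measureReal_nonneg⟩)

lemma lintegral_mul_le_riskNorm_mul_gaugeNorm (hY : Measurable Y) (hZ : Measurable Z)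
    (hZi : Integrable Z P) (hfin : gaugeNorm P σ Z ≠ ∞) :
    ∫⁻ ω, ENNReal.ofReal |Y ω * Z ω| ∂P ≤ riskNorm P σ Y * gaugeNorm P σ Z := by
  lift gaugeNorm P σ Z to ℝ≥0 using hfin with η hη
  exact lintegral_mul_le_of_dominated σ hY hZ hZi (dominated_of_gaugeNorm_le σ hη.ge)

/-! ### Domination from bounds on events. -/

lemma measureReal_lt_le_of_forall_lt {s α : ℝ}
    (h : ∀ t < s, P.real {ω | X ω ≤ t} ≤ α) : P.real {ω | X ω < s} ≤ α := by
  have hU : {ω | X ω < s} = ⋃ n : ℕ, {ω | X ω ≤ s - 1 / ((n : ℝ) + 1)} := by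
    ext ω
    simp only [mem_ofPred_eq, mem_iUnion]
    constructor
    · intro hω
      obtain ⟨n, hn⟩ := exists_nat_one_div_lt (sub_pos.2 hω)
      exact ⟨n, by linarith⟩
    · rintro ⟨n, hn⟩
      have : (0 : ℝ) < 1 / ((n : ℝ) + 1) := Nat.one_div_pos_of_nat
      linarith
  have hmono : Monotone fun n : ℕ => {ω | X ω ≤ s - 1 / ((n : ℝ) + 1)} := by
    intro m n hmn ω hω
    have := Nat.one_div_le_one_div (α := ℝ) hmn
    have hω' : X ω ≤ s - 1 / ((m : ℝ) + 1) := hω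
    change X ω ≤ s - 1 / ((n : ℝ) + 1)
    linarith
  have ht := (ENNReal.tendsto_toReal (measure_ne_top P _)).comp
    (tendsto_measure_iUnion_atTop (μ := P) hmono)
  rw [hU]
  refine le_of_tendsto ht (Eventually.of_forall fun n => h _ ?_)
  have : (0 : ℝ) < 1 / ((n : ℝ) + 1) := Nat.one_div_pos_of_nat
  linarith

lemma exists_quantile (hX : Measurable X) (hX0 : ∀ ω, 0 ≤ X ω) {α : ℝ}
    (hα : α ∈ Ico (0 : ℝ) 1) :
    ∃ s : ℝ, 0 ≤ s ∧ P.real {ω | X ω < s} ≤ α ∧ α ≤ P.real {ω | X ω ≤ s} := by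
  rcases hα.1.eq_or_lt with rfl | h0
  · refine ⟨0, le_rfl, ?_, measureReal_nonneg⟩
    have : {ω | X ω < 0} = ∅ := eq_empty_of_forall_notMem fun ω hω =>
      absurd hω (not_lt.2 (hX0 ω))
    simp [this]
  · refine ⟨VaR P X α, VaR_nonneg hX0 h0, measureReal_lt_le_of_forall_lt fun t ht => ?_,
      (VaR_le_iff hX h0 hα.2).1 le_rfl⟩
    rw [← not_le, VaR_le_iff hX h0 hα.2, not_le] at ht
    exact ht.le

/-- An event consisting of the largest values of `|Z|` with probability exactly `1 - α` would give
the claim at once, but atoms may exclude it. With `s` an `α`-quantile, the events `{s ≤ |Z|}` and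
`{s < |Z|}` have probabilities on either side of `1 - α`. The supergradient `σ α` of the concave
tail function corrects the bound from one of them to level `α`. -/
lemma dominated_of_setIntegral_le (hZ : Measurable Z) (hZi : Integrable Z P) {η : ℝ}
    (hη : 0 ≤ η) (h : ∀ A, MeasurableSet A →
      ∫ ω in A, |Z ω| ∂P ≤ η * (σ.upperTail (1 - P.real A)).toReal) :
    Dominated P σ Z η := by
  rw [dominated_iff]
  intro α hα
  have hX := hZ.abs
  have hX0 : ∀ ω, 0 ≤ |Z ω| := fun _ => abs_nonneg _
  obtain ⟨s, hs, hlt, hle⟩ := exists_quantile (P := P) hX hX0 hα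
  have hpos : Integrable (fun ω => max (|Z ω| - s) 0) P :=
    (hZi.abs.sub (integrable_const s)).pos_part
  set T := ∫ ω, max (|Z ω| - s) 0 ∂P with hT
  have hT0 : 0 ≤ T := integral_nonneg fun _ => le_max_right _ _
  have htail : ∫ u in α..1, VaR P (fun ω => |Z ω|) u ≤ (1 - α) * s + T := by
    rw [← toReal_tail hX hX0 hα]
    refine ENNReal.toReal_le_of_le_ofReal ?_ ((tail_le hX hX0 hα.1 hs).trans_eq ?_)
    · exact add_nonneg (mul_nonneg (sub_nonneg.2 hα.2.le) hs) hT0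
    · rw [ENNReal.ofReal_add (mul_nonneg (sub_nonneg.2 hα.2.le) hs) hT0, ENNReal.ofReal_mul (sub_nonneg.2 hα.2.le),
        hT, ofReal_integral_eq_lintegral_ofReal hpos
          (Eventually.of_forall fun _ => le_max_right _ _)]
      simp [ENNReal.ofReal_max]
  -- For such `A`, `|Z| 1_A = (|Z| - s)^+ + s 1_A`, since `|Z| = s` on the part of `A` outside `{s <
  -- |Z|}`.
  have split : ∀ A, MeasurableSet A → {ω | s < |Z ω|} ⊆ A → A ⊆ {ω | s ≤ |Z ω|} →
      ∫ ω in A, |Z ω| ∂P = T + P.real A * s := by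
    intro A hA h1 h2
    have e : ∀ ω, A.indicator (fun ω => |Z ω|) ω
        = max (|Z ω| - s) 0 + A.indicator (fun _ => s) ω := by
      intro ω
      by_cases hω : ω ∈ A
      · have : s ≤ |Z ω| := h2 hω
        rw [indicator_of_mem hω, indicator_of_mem hω, max_eq_left (by linarith)]
        ring
      · have : |Z ω| ≤ s := not_lt.1 fun h' => hω (h1 h')
        rw [indicator_of_notMem hω, indicator_of_notMem hω, max_eq_right (by linarith)]
        ring
    rw [← integral_indicator hA]
    simp only [e]
    rw [integral_add hpos ((integrable_const s).indicator hA), integral_indicator_const _ hA,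
      smul_eq_mul]
  have bound : ∀ A, MeasurableSet A → {ω | s < |Z ω|} ⊆ A → A ⊆ {ω | s ≤ |Z ω|} →
      T + P.real A * s ≤ η * ((∫ u in α..1, σ u) - (1 - P.real A - α) * σ α) := by
    intro A hA h1 h2
    have ha : 1 - P.real A ∈ Icc (0 : ℝ) 1 :=
      ⟨sub_nonneg.2 measureReal_le_one, sub_le_self _ measureReal_nonneg⟩
    rw [← split A hA h1 h2]
    refine (h A hA).trans (mul_le_mul_of_nonneg_left ?_ hη)
    rw [σ.upperTail_eq ha, ENNReal.toReal_ofReal]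
    · exact σ.integral_le_supergradient ha hα
    · rw [intervalIntegral.integral_of_le ha.2, integral_Ioc_eq_integral_Ioo]
      exact setIntegral_nonneg measurableSet_Ioo fun u hu => σ.nonneg u ⟨ha.1.trans hu.1.le, hu.2⟩
  refine htail.trans ?_
  -- Replacing `P(A)` by `1 - α` changes the left side of `bound` at rate `s` and the right side at
  -- rate `η σ(α)`. The larger rate decides from which side to approach: the larger event if `η σ(α)
  -- ≤ s`, the smaller one otherwise.
  rcases le_total (η * σ α) s with hc | hc
  · have hm : MeasurableSet {ω | |Z ω| < s} := measurableSet_lt hX measurable_const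
    have hb := bound {ω | |Z ω| < s}ᶜ hm.compl (fun ω hω => by simpa using le_of_lt hω)
      (fun ω hω => by simpa using hω)
    rw [probReal_compl_eq_one_sub hm] at hb
    nlinarith [mul_nonneg (sub_nonneg.2 hc) (sub_nonneg.2 hlt)]
  · have hm : MeasurableSet {ω | |Z ω| ≤ s} := measurableSet_le hX measurable_const
    have hb := bound {ω | |Z ω| ≤ s}ᶜ hm.compl (fun ω hω => by simpa using hω)
      (fun ω hω => le_of_lt (by simpa using hω))
    rw [probReal_compl_eq_one_sub hm] at hb
    nlinarith [mul_nonneg (sub_nonneg.2 hc) (sub_nonneg.2 hle)]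

end analysis

/-! ### The pairing as a bounded bilinear map. -/

section duality

variable {Ω : Type*} [MeasurableSpace Ω] (P : Measure Ω) [IsProbabilityMeasure P] (σ : Spectrum)

lemma NaturalDomain.norm_def (Y : NaturalDomain P σ) : ‖Y‖ = (riskNorm P σ Y.1).toReal := rfl

lemma GaugeDomain.norm_def (Z : GaugeDomain P σ) : ‖Z‖ = (gaugeNorm P σ Z.1).toReal := rfl

lemma integrable_mul_and_lintegral_le (Y : NaturalDomain P σ) (Z : GaugeDomain P σ) :
    Integrable (fun ω => Y.1 ω * Z.1 ω) P ∧
      (∫⁻ ω, ENNReal.ofReal |Y.1 ω * Z.1 ω| ∂P).toReal ≤ ‖Y‖ * ‖Z‖ := by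
  have hY : riskNorm P σ Y.1 < ∞ := Y.2
  have hZ : gaugeNorm P σ Z.1 < ∞ := Z.2.2
  have h := lintegral_mul_le_riskNorm_mul_gaugeNorm σ Y.1.measurable Z.1.measurable Z.2.1 hZ.ne
  have hfin := ENNReal.mul_lt_top hY hZ
  refine ⟨⟨(Y.1.measurable.mul Z.1.measurable).aestronglyMeasurable, ?_⟩, ?_⟩
  · rw [hasFiniteIntegral_iff_norm]
    exact h.trans_lt hfin
  · rw [NaturalDomain.norm_def, GaugeDomain.norm_def, ← ENNReal.toReal_mul]
    exact ENNReal.toReal_mono hfin.ne h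

lemma integrable_mul (Y : NaturalDomain P σ) (Z : GaugeDomain P σ) :
    Integrable (fun ω => Y.1 ω * Z.1 ω) P :=
  (integrable_mul_and_lintegral_le P σ Y Z).1

lemma abs_integral_mul_le (Y : NaturalDomain P σ) (Z : GaugeDomain P σ) :
    |∫ ω, Y.1 ω * Z.1 ω ∂P| ≤ ‖Y‖ * ‖Z‖ :=
  (Real.norm_eq_abs _).symm.trans_le <|
    (norm_integral_le_lintegral_norm _).trans (integrable_mul_and_lintegral_le P σ Y Z).2

/-- The bilinear pairing `(Z, Y) ↦ E YZ` of `L_σ^*` with `L_σ`. -/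
noncomputable def pairing : GaugeDomain P σ →L[ℝ] StrongDual ℝ (NaturalDomain P σ) :=
  LinearMap.mkContinuous₂
    (LinearMap.mk₂ ℝ (fun (Z : GaugeDomain P σ) (Y : NaturalDomain P σ) =>
        ∫ ω, Y.1 ω * Z.1 ω ∂P)
      (fun Z Z' Y => by
        rw [← integral_add (integrable_mul P σ Y Z) (integrable_mul P σ Y Z')]
        refine integral_congr_ae ?_
        filter_upwards [AEEqFun.coeFn_add Z.1 Z'.1] with ω hω
        rw [Submodule.coe_add, hω, Pi.add_apply, mul_add])
      (fun c Z Y => by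
        rw [smul_eq_mul, ← integral_const_mul]
        refine integral_congr_ae ?_
        filter_upwards [AEEqFun.coeFn_smul c Z.1] with ω hω
        rw [Submodule.coe_smul, hω, Pi.smul_apply, smul_eq_mul, mul_left_comm])
      (fun Z Y Y' => by
        rw [← integral_add (integrable_mul P σ Y Z) (integrable_mul P σ Y' Z)]
        refine integral_congr_ae ?_
        filter_upwards [AEEqFun.coeFn_add Y.1 Y'.1] with ω hω
        rw [Submodule.coe_add, hω, Pi.add_apply, add_mul])
      (fun c Z Y => by
        rw [smul_eq_mul, ← integral_const_mul]
        refine integral_congr_ae ?_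
        filter_upwards [AEEqFun.coeFn_smul c Y.1] with ω hω
        rw [Submodule.coe_smul, hω, Pi.smul_apply, smul_eq_mul, mul_assoc]))
    1 fun Z Y => by
      rw [one_mul, mul_comm]
      exact abs_integral_mul_le P σ Y Z

lemma pairing_apply (Z : GaugeDomain P σ) (Y : NaturalDomain P σ) :
    pairing P σ Z Y = ∫ ω, Y.1 ω * Z.1 ω ∂P := rfl

lemma norm_pairing_le (Z : GaugeDomain P σ) : ‖pairing P σ Z‖ ≤ ‖Z‖ :=
  ContinuousLinearMap.opNorm_le_bound _ (norm_nonneg _) fun Y => by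
    rw [mul_comm]
    exact abs_integral_mul_le P σ Y Z

/-! ### Simple functions and indicators in the natural domain. -/

lemma riskNorm_simpleFunc_lt_top (f : SimpleFunc Ω ℝ) : riskNorm P σ f < ∞ := by
  obtain ⟨C, hC⟩ := f.exists_forall_norm_le
  exact (riskNorm_le_of_abs_le σ f.measurable hC).trans_lt ENNReal.ofReal_lt_top

/-- Simple functions as elements of `L_σ`. -/
noncomputable def NaturalDomain.ofSimple : SimpleFunc Ω ℝ →ₗ[ℝ] NaturalDomain P σ where
  toFun f := ⟨AEEqFun.mk f f.aestronglyMeasurable, by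
    change riskNorm P σ _ < ∞
    rw [riskNorm_congr σ (AEEqFun.coeFn_mk _ _)]
    exact riskNorm_simpleFunc_lt_top P σ f⟩
  map_add' _ _ := rfl
  map_smul' _ _ := rfl

lemma NaturalDomain.coe_ofSimple (f : SimpleFunc Ω ℝ) : (ofSimple P σ f).1 =ᵐ[P] f :=
  AEEqFun.coeFn_mk _ _

lemma NaturalDomain.norm_ofSimple (f : SimpleFunc Ω ℝ) :
    ‖ofSimple P σ f‖ = (riskNorm P σ f).toReal := by
  rw [norm_def, riskNorm_congr σ (coe_ofSimple P σ f)]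

/-- The indicator function of `A` as an element of `L_σ` (zero if `A` is not measurable). -/
noncomputable def NaturalDomain.indicator (A : Set Ω) : NaturalDomain P σ :=
  ofSimple P σ ((SimpleFunc.const Ω 1).restrict A)

lemma NaturalDomain.coe_indicator {A : Set Ω} (hA : MeasurableSet A) :
    (NaturalDomain.indicator P σ A).1 =ᵐ[P] A.indicator fun _ => (1 : ℝ) := by
  refine (coe_ofSimple P σ _).trans (Eventually.of_forall fun ω => ?_)
  rw [SimpleFunc.coe_restrict _ hA]
  rfl

lemma NaturalDomain.norm_indicator {A : Set Ω} (hA : MeasurableSet A) :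
    ‖NaturalDomain.indicator P σ A‖ = (σ.upperTail (1 - P.real A)).toReal := by
  rw [NaturalDomain.indicator, norm_ofSimple, riskNorm_of_abs_eq_indicator σ
    (SimpleFunc.measurable _) hA fun ω => ?_]
  rw [SimpleFunc.coe_restrict _ hA]
  by_cases hω : ω ∈ A <;> simp [hω]

lemma NaturalDomain.indicator_union {A B : Set Ω} (hA : MeasurableSet A) (hB : MeasurableSet B)
    (hAB : Disjoint A B) : NaturalDomain.indicator P σ (A ∪ B)
      = NaturalDomain.indicator P σ A + NaturalDomain.indicator P σ B := by
  unfold NaturalDomain.indicator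
  rw [← map_add]
  congr 1
  ext ω
  rw [SimpleFunc.coe_add, SimpleFunc.coe_restrict _ hA, SimpleFunc.coe_restrict _ hB,
    SimpleFunc.coe_restrict _ (hA.union hB), indicator_union_of_disjoint hAB]
  rfl

lemma NaturalDomain.indicator_biUnion {A : ℕ → Set Ω} (hA : ∀ i, MeasurableSet (A i))
    (hd : Pairwise fun i j => Disjoint (A i) (A j)) (s : Finset ℕ) :
    NaturalDomain.indicator P σ (⋃ i ∈ s, A i) = ∑ i ∈ s, NaturalDomain.indicator P σ (A i) := by
  induction s using Finset.induction_on with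
  | empty => simp [NaturalDomain.indicator]
  | insert a s ha ih =>
    rw [Finset.sum_insert ha, Finset.set_biUnion_insert, ← ih]
    refine indicator_union P σ (hA a) (s.measurableSet_biUnion fun i _ => hA i) ?_
    exact disjoint_iUnion₂_right.2 fun i hi => hd (ne_of_mem_of_not_mem hi ha).symm

/-- The remainder after a finite subfamily is the indicator of an event whose probability tends to
zero, and its norm is the tail integral of `σ` at one minus that probability. -/
lemma NaturalDomain.hasSum_indicator {A : ℕ → Set Ω} (hA : ∀ i, MeasurableSet (A i))
    (hd : Pairwise fun i j => Disjoint (A i) (A j)) : HasSum (fun i => NaturalDomain.indicator P σ (A i))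
      (NaturalDomain.indicator P σ (⋃ i, A i)) := by
  have hU := MeasurableSet.iUnion hA
  have hs : ∀ s : Finset ℕ, MeasurableSet (⋃ i ∈ s, A i) := fun s =>
    s.measurableSet_biUnion fun i _ => hA i
  have hsub : ∀ s : Finset ℕ, (⋃ i ∈ s, A i) ⊆ ⋃ i, A i := fun s =>
    iUnion₂_subset fun i _ => subset_iUnion A i
  have hP : Tendsto (fun s : Finset ℕ => 1 - P.real ((⋃ i, A i) \ ⋃ i ∈ s, A i)) atTop (𝓝 1) := by
    -- Countable additivity of `P` as a real-valued measure, giving convergence along finite subsets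
    -- as `HasSum` requires.
    have h := P.toSignedMeasure.m_iUnion hA hd
    simp only [Measure.toSignedMeasure_apply_measurable (hA _),
      Measure.toSignedMeasure_apply_measurable hU] at h
    have h2 := (tendsto_const_nhds (x := (1 : ℝ))).sub
      ((tendsto_const_nhds (x := P.real (⋃ i, A i))).sub h)
    rw [sub_self, sub_zero] at h2
    refine h2.congr fun s => ?_
    rw [measureReal_sdiff (hsub s) (hs s),
      measureReal_biUnion_finset (fun i _ j _ hij => hd hij) fun i _ => hA i]
  have ht := (ENNReal.tendsto_toReal ENNReal.zero_ne_top).comp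
    (σ.tendsto_upperTail (fun _ => sub_nonneg.2 measureReal_le_one) hP)
  rw [HasSum, SummationFilter.unconditional_filter, tendsto_iff_norm_sub_tendsto_zero]
  refine ht.congr fun s => ?_
  rw [← indicator_biUnion P σ hA hd s, norm_sub_rev, Function.comp_apply,
    ← norm_indicator P σ (hU.diff (hs s))]
  congr 1
  rw [eq_sub_iff_add_eq, ← indicator_union P σ (hU.diff (hs s)) (hs s) disjoint_sdiff_left,
    sdiff_union_of_subset (hsub s)]

/-! ### From a functional to its density. -/

variable {P σ}

/-- The signed measure `A ↦ ζ(1_A)` of a continuous linear functional `ζ` on `L_σ`. -/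
noncomputable def functionalMeasure (ζ : StrongDual ℝ (NaturalDomain P σ)) : SignedMeasure Ω where
  measureOf' A := ζ (NaturalDomain.indicator P σ A)
  empty' := by simp [NaturalDomain.indicator]
  not_measurable' A hA := by
    simp [NaturalDomain.indicator, SimpleFunc.restrict_of_not_measurable hA]
  m_iUnion' _ hA hd := (NaturalDomain.hasSum_indicator P σ hA hd).mapL ζ

lemma functionalMeasure_apply (ζ : StrongDual ℝ (NaturalDomain P σ)) (A : Set Ω) :
    functionalMeasure ζ A = ζ (NaturalDomain.indicator P σ A) := rfl

lemma functionalMeasure_absolutelyContinuous (ζ : StrongDual ℝ (NaturalDomain P σ)) :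
    VectorMeasure.AbsolutelyContinuous (functionalMeasure ζ) P.toENNRealVectorMeasure := by
  refine VectorMeasure.AbsolutelyContinuous.mk fun A hA h0 => ?_
  rw [Measure.toENNRealVectorMeasure_apply_measurable hA] at h0
  have : NaturalDomain.indicator P σ A = 0 := by
    rw [← norm_eq_zero, NaturalDomain.norm_indicator P σ hA, measureReal_def, h0]
    simp [σ.upperTail_one]
  rw [functionalMeasure_apply, this, map_zero]

lemma setIntegral_rnDeriv_functionalMeasure (ζ : StrongDual ℝ (NaturalDomain P σ)) {A : Set Ω}
    (hA : MeasurableSet A) :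
    ∫ ω in A, (functionalMeasure ζ).rnDeriv P ω ∂P = ζ (NaturalDomain.indicator P σ A) := by
  rw [← withDensityᵥ_apply (SignedMeasure.integrable_rnDeriv _ _) hA,
    SignedMeasure.withDensityᵥ_rnDeriv_eq _ _ (functionalMeasure_absolutelyContinuous ζ),
    functionalMeasure_apply]

/-- Test `ζ` on `sgn(Z) 1_A`: its value is `E[|Z|; A]`, while its norm is that of `1_A`. This serves
both for constructing the density and for the lower bound in the isometry. -/
lemma dominated_of_setIntegral_eq (ζ : StrongDual ℝ (NaturalDomain P σ)) {Z : Ω → ℝ}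
    (hZ : Measurable Z) (hZi : Integrable Z P) (h : ∀ A, MeasurableSet A →
      ∫ ω in A, Z ω ∂P = ζ (NaturalDomain.indicator P σ A)) : Dominated P σ Z ‖ζ‖ := by
  refine dominated_of_setIntegral_le σ hZ hZi (norm_nonneg _) fun A hA => ?_
  have hN : MeasurableSet {ω | 0 ≤ Z ω} := measurableSet_le measurable_const hZ
  have h1 := hA.inter hN
  have h2 := hA.diff hN
  have e : ∫ ω in A, |Z ω| ∂P = ζ (NaturalDomain.indicator P σ (A ∩ {ω | 0 ≤ Z ω})
      - NaturalDomain.indicator P σ (A \ {ω | 0 ≤ Z ω})) := by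
    rw [map_sub, ← h _ h1, ← h _ h2, ← integral_inter_add_sdiff hN hZi.abs.integrableOn,
      sub_eq_add_neg, ← integral_neg]
    congr 1
    · exact setIntegral_congr_fun h1 fun ω hω => abs_of_nonneg hω.2
    · exact setIntegral_congr_fun h2 fun ω hω => abs_of_nonpos (not_le.1 hω.2).le
  rw [e]
  refine (le_abs_self _).trans ((ζ.le_opNorm _).trans_eq ?_)
  congr 1
  rw [NaturalDomain.indicator, NaturalDomain.indicator, ← map_sub, NaturalDomain.norm_ofSimple,
    riskNorm_of_abs_eq_indicator σ (SimpleFunc.measurable _) hA fun ω => ?_]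
  rw [SimpleFunc.coe_sub, Pi.sub_apply, SimpleFunc.coe_restrict _ h1,
    SimpleFunc.coe_restrict _ h2]
  by_cases hω : ω ∈ A <;> by_cases hω' : 0 ≤ Z ω <;> simp [hω, hω']

/-- Linearity passes from indicators to simple functions, and these are dense in `L_σ`. -/
lemma dual_ext {ζ ξ : StrongDual ℝ (NaturalDomain P σ)} (h : ∀ A, MeasurableSet A →
    ζ (NaturalDomain.indicator P σ A) = ξ (NaturalDomain.indicator P σ A)) : ζ = ξ := by
  have hsimple : ∀ f : SimpleFunc Ω ℝ,
      ζ (NaturalDomain.ofSimple P σ f) = ξ (NaturalDomain.ofSimple P σ f) := by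
    intro f
    induction f using SimpleFunc.induction with
    | const c hA =>
      rename_i A
      have : SimpleFunc.piecewise A hA (SimpleFunc.const Ω c) (SimpleFunc.const Ω 0)
          = c • (SimpleFunc.const Ω (1 : ℝ)).restrict A := by
        ext ω
        rw [SimpleFunc.coe_smul, Pi.smul_apply, SimpleFunc.coe_restrict _ hA]
        by_cases hω : ω ∈ A <;> simp [hω]
      rw [this, map_smul, map_smul, map_smul]
      exact congrArg _ (h A hA)
    | add _ hf hg => rw [map_add, map_add, map_add, hf, hg]
  ext Y
  have hY : Measurable Y.1 := Y.1.measurable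
  -- Base point `0` ensures `|f n - Y| ≤ |Y|`, the domination needed for convergence in norm.
  set f : ℕ → SimpleFunc Ω ℝ := SimpleFunc.approxOn Y.1 hY univ 0 (mem_univ 0)
  have hlim : Tendsto (fun n => NaturalDomain.ofSimple P σ (f n)) atTop (𝓝 Y) := by
    rw [tendsto_iff_norm_sub_tendsto_zero]
    have h0 := (ENNReal.tendsto_toReal ENNReal.zero_ne_top).comp
      (tendsto_riskNorm_zero (P := P) σ (Y := fun n ω => f n ω - Y.1 ω) (X := Y.1)
        (fun n => (f n).measurable.sub hY) hY Y.2 (fun n ω => ?_) fun ω => ?_)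
    · refine h0.congr fun n => ?_
      rw [Function.comp_apply, NaturalDomain.norm_def]
      congr 1
      refine riskNorm_congr σ ?_
      filter_upwards [AEEqFun.coeFn_sub (NaturalDomain.ofSimple P σ (f n)).1 Y.1,
        NaturalDomain.coe_ofSimple P σ (f n)] with ω h1 h2
      rw [Submodule.coe_sub, h1, Pi.sub_apply, h2]
    · have := SimpleFunc.edist_approxOn_le hY (mem_univ (0 : ℝ)) ω n
      rw [edist_dist, edist_dist, ENNReal.ofReal_le_ofReal_iff dist_nonneg, Real.dist_eq,
        Real.dist_eq, zero_sub, abs_neg] at this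
      exact this
    · have := SimpleFunc.tendsto_approxOn hY (mem_univ (0 : ℝ)) (x := ω) (by simp)
      simpa using this.sub_const (Y.1 ω)
  refine tendsto_nhds_unique ((ζ.continuous.tendsto Y).comp hlim) ?_
  refine ((ξ.continuous.tendsto Y).comp hlim).congr fun n => ?_
  exact (hsimple (f n)).symm

/-! ### Isometry and surjectivity. -/

lemma pairing_indicator (Z : GaugeDomain P σ) {A : Set Ω} (hA : MeasurableSet A) :
    pairing P σ Z (NaturalDomain.indicator P σ A) = ∫ ω in A, Z.1 ω ∂P := by
  rw [pairing_apply, ← integral_indicator hA]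
  refine integral_congr_ae ?_
  filter_upwards [NaturalDomain.coe_indicator P σ hA] with ω hω
  rw [hω]
  by_cases h : ω ∈ A <;> simp [h]

/-- The upper bound is Hölder. For the lower one, `Z` is itself the density of its functional, so
`|Z|` is dominated with constant the operator norm. -/
lemma norm_pairing (Z : GaugeDomain P σ) : ‖pairing P σ Z‖ = ‖Z‖ := by
  refine le_antisymm (norm_pairing_le P σ Z) ?_
  have h := dominated_of_setIntegral_eq (pairing P σ Z) Z.1.measurable Z.2.1
    fun A hA => (pairing_indicator Z hA).symm
  rw [GaugeDomain.norm_def]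
  exact ENNReal.toReal_le_of_le_ofReal (norm_nonneg _)
    (((gaugeNorm_le_iff (η := ‖pairing P σ Z‖₊) σ).2 h).trans_eq (ofReal_norm _).symm)

/-- The Radon–Nikodym density of `A ↦ ζ(1_A)` as an element of `L_σ^*`. -/
noncomputable def dualDensity (ζ : StrongDual ℝ (NaturalDomain P σ)) : GaugeDomain P σ :=
  ⟨AEEqFun.mk ((functionalMeasure ζ).rnDeriv P)
      (SignedMeasure.integrable_rnDeriv _ _).aestronglyMeasurable,
    (SignedMeasure.integrable_rnDeriv _ _).congr (AEEqFun.coeFn_mk _ _).symm, by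
      rw [gaugeNorm_congr σ (AEEqFun.coeFn_mk _ _)]
      exact ((gaugeNorm_le_iff (η := ‖ζ‖₊) σ).2
        (dominated_of_setIntegral_eq ζ (SignedMeasure.measurable_rnDeriv _ _)
          (SignedMeasure.integrable_rnDeriv _ _)
          fun A hA => setIntegral_rnDeriv_functionalMeasure ζ hA)).trans_lt ENNReal.coe_lt_top⟩

lemma coe_dualDensity (ζ : StrongDual ℝ (NaturalDomain P σ)) :
    (dualDensity ζ).1 =ᵐ[P] (functionalMeasure ζ).rnDeriv P :=
  AEEqFun.coeFn_mk _ _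

lemma pairing_dualDensity (ζ : StrongDual ℝ (NaturalDomain P σ)) :
    pairing P σ (dualDensity ζ) = ζ := by
  refine dual_ext fun A hA => ?_
  rw [pairing_indicator _ hA, ← setIntegral_rnDeriv_functionalMeasure ζ hA]
  exact integral_congr_ae (ae_restrict_of_ae (coe_dualDensity ζ))

variable (P σ)

/-- The isometric identification of `L_σ^*` with the dual of `L_σ`. -/
noncomputable def dualEquiv :
    GaugeDomain P σ ≃ₗᵢ[ℝ] StrongDual ℝ (NaturalDomain P σ) :=
  LinearIsometryEquiv.ofSurjective ⟨(pairing P σ).toLinearMap, norm_pairing⟩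
    fun ζ => ⟨dualDensity ζ, pairing_dualDensity ζ⟩

lemma dualEquiv_apply (Z : GaugeDomain P σ) : dualEquiv P σ Z = pairing P σ Z := rfl

lemma dualEquiv_symm_apply (ζ : StrongDual ℝ (NaturalDomain P σ)) :
    (dualEquiv P σ).symm ζ = dualDensity ζ := by
  rw [LinearIsometryEquiv.symm_apply_eq, dualEquiv_apply, pairing_dualDensity]

end duality

end SpectralRisk

theorem mainTheorem3 {Ω : Type*} [MeasurableSpace Ω] (P : Measure Ω) [IsProbabilityMeasure P]
    (σ : SpectralRisk.Spectrum) :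
    -- the pairing is well defined and satisfies the Hölder-type inequality
    (∀ (Y : SpectralRisk.NaturalDomain P σ) (Z : SpectralRisk.GaugeDomain P σ),
      Integrable (fun ω => Y.1 ω * Z.1 ω) P ∧ |∫ ω, Y.1 ω * Z.1 ω ∂P| ≤ ‖Y‖ * ‖Z‖) ∧
    -- the pairing identifies `L_σ^*` isometrically with the whole topological dual of `L_σ`
    ∃ Φ : SpectralRisk.GaugeDomain P σ ≃ₗᵢ[ℝ] StrongDual ℝ (SpectralRisk.NaturalDomain P σ),
      (∀ (Z : SpectralRisk.GaugeDomain P σ) (Y : SpectralRisk.NaturalDomain P σ),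
        Φ Z Y = ∫ ω, Y.1 ω * Z.1 ω ∂P) ∧
      -- the representing `Z` is the Radon–Nikodym density of the signed measure `A ↦ ζ(1_A)`
      ∀ ζ : StrongDual ℝ (SpectralRisk.NaturalDomain P σ), ∃ m : SignedMeasure Ω,
        (∀ A : Set Ω, MeasurableSet A → ∃ Y : SpectralRisk.NaturalDomain P σ,
          Y.1 =ᵐ[P] A.indicator (fun _ => (1 : ℝ)) ∧ m A = ζ Y) ∧
        VectorMeasure.AbsolutelyContinuous m P.toENNRealVectorMeasure ∧
        (Φ.symm ζ).1 =ᵐ[P] m.rnDeriv P := by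
  refine ⟨fun Y Z => ⟨SpectralRisk.integrable_mul P σ Y Z,
    SpectralRisk.abs_integral_mul_le P σ Y Z⟩, SpectralRisk.dualEquiv P σ, fun Z Y => rfl,
    fun ζ => ⟨SpectralRisk.functionalMeasure ζ, fun A hA => ?_,
      SpectralRisk.functionalMeasure_absolutelyContinuous ζ, ?_⟩⟩
  · exact ⟨SpectralRisk.NaturalDomain.indicator P σ A,
      SpectralRisk.NaturalDomain.coe_indicator P σ hA,
      SpectralRisk.functionalMeasure_apply ζ A⟩
  · rw [SpectralRisk.dualEquiv_symm_apply]
    exact SpectralRisk.coe_dualDensity ζ
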